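/- **Environment.** Let $V\subset\mathbb{R}$ be compact with $\underline v=\min V<\max V=\overline v$, let $\mu$ be a Borel probability measure with support $V$, and let $c:V\to\mathbb{R}$ be continuous with $c(v)\le v$ for all $v\in V$ and $\int (v-c(v))\,\mu(\mathrm{d}v)>0$. Write $\Gamma=(c,\mu)$. **Information structures and the game.** An information structure $\tau$ consists of complete separable metric spaces $T_s,T_b$ (with Borel $\sigma$-algebras) and a probability measure $P$ on $T_s\times T_b\times V$ whose marginal on $V$ is $\mu$. The triple $(t_s,t_b,v)$ is drawn from $P$; Seller observes $t_s$ and Buyer observes $t_b$; Seller posts a price $p\in\mathbb{R}$; Buyer accepts or rejects. If Buyer accepts, Buyer gets $v-p$ and Seller gets $p-c(v)$; otherwise both get $0$. A strategy of Seller is a probability measure $\sigma$ on $\mathbb{R}\times T_s$ whose marginal on $T_s$ is that of $P$, with regular conditional distribution $\sigma(\mathrm{d}p|t_s)$; a strategy of Buyer is a measurable function $\alpha:\mathbb{R}\times T_b\to[0,1]$; beliefs are a Markov kernel $\nu(\cdot|p,t_b)$ from $\mathbb{R}\times T_b$ to $V$. The payoffs are $$\pi_b=\int (v-p)\,\alpha(p,t_b)\,\sigma(\mathrm{d}p|t_s)\,P(\mathrm{d}t_s,\mathrm{d}t_b,\mathrm{d}v),\qquad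 \pi_s=\int (p-c(v))\,\alpha(p,t_b)\,\sigma(\mathrm{d}p|t_s)\,P(\mathrm{d}t_s,\mathrm{d}t_b,\mathrm{d}v).$$ **Equilibrium.** $(\sigma,\alpha,\nu)$ is a weak perfect Bayesian equilibrium (wPBE) of $(\Gamma,\tau)$ if (1) for all $(p,t_b)$, $\alpha(p,t_b)=1$ when $\int v\,\nu(\mathrm{d}v|p,t_b)>p$ and $\alpha(p,t_b)=0$ when $\int v\,\nu(\mathrm{d}v|p,t_b)<p$; (2) $\sigma$ maximizes $\pi_s$ over all strategies of Seller, given $\alpha$ (the value $-\infty$ being allowed for deviations); (3) $\nu$ satisfies Bayes' rule on path, that is, under the joint law $\sigma(\mathrm{d}p|t_s)P(\mathrm{d}t_s,\mathrm{d}t_b,\mathrm{d}v)$, $\nu(\cdot|p,t_b)$ is a conditional distribution of $v$ given $(p,t_b)$. Beliefs are *price-independent* if for every $p\in\mathbb{R}$ and every measurable $D\subset T_b\times V$, $$\int_D \nu(\mathrm{d}v|p,t_b)\,P(T_s,\mathrm{d}t_b,V)=\int_D P(T_s,\mathrm{d}t_b,\mathrm{d}v).$$ The structure $\tau$ has a *fully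 informed Buyer* if $T_b=V$ and $t_b=v$ $P$-almost surely. Let $\mathbf{\Pi}(\Gamma)$ be the set of pairs $(\pi_b,\pi_s)$ that are the payoffs of some wPBE of $(\Gamma,\tau)$ for some information structure $\tau$, and let $\mathbf{\Pi}^*_{fb}(\Gamma)$ be the set of pairs $(\pi_b,\pi_s)$ that are the payoffs of some wPBE with price-independent beliefs of $(\Gamma,\tau)$ for some $\tau$ with a fully informed Buyer. Put $$\underline{\pi}_s^{fb}(\Gamma)=\sup_{p\in\mathbb{R}}\int_{\{v\ge p\}}(p-c(v))\,\mu(\mathrm{d}v).$$ **Theorem.** For every environment $\Gamma$, $$\mathbf{\Pi}^*_{fb}(\Gamma)=\left\{(\pi_b,\pi_s)\in\mathbf{\Pi}(\Gamma):\ \pi_s\ge\underline{\pi}_s^{fb}(\Gamma)\right\}.$$ -/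

import Mathlib

open MeasureTheory ProbabilityTheory

noncomputable section

/-- An environment `Γ = (c, μ)`: a compact set `V ⊆ ℝ` of Buyer's values with `min V < max V`,
a prior `μ` on `V` whose support is all of `V`, and a continuous cost function `c : V → ℝ` with
`c v ≤ v` everywhere and positive expected surplus. -/
structure Environment where
  /-- the set of Buyer's possible values -/
  V : Set ℝ
  isCompact_V : IsCompact V
  /-- `V` has at least two points, that is, `min V < max V` -/
  nontrivial_V : V.Nontrivial
  /-- the prior distribution of the value -/
  μ : Measure V
  isProbabilityMeasure_μ : IsProbabilityMeasure μ
  /-- the support of `μ` is `V` -/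
  support_μ : μ.support = Set.univ
  /-- Seller's cost -/
  c : V → ℝ
  continuous_c : Continuous c
  c_le : ∀ v : V, c v ≤ (v : ℝ)
  surplus_pos : 0 < ∫ v : V, ((v : ℝ) - c v) ∂μ

/-- An information structure for `Γ` with signal spaces `Ts` (Seller) and `Tb` (Buyer): a joint
distribution `P` of `(t_s, t_b, v)` whose marginal on `V` is the prior. -/
structure InfoStructure (Γ : Environment) (Ts Tb : Type) [MeasurableSpace Ts]
    [MeasurableSpace Tb] where
  /-- the joint law of `(t_s, t_b, v)` -/
  P : Measure (Ts × Tb × Γ.V)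
  isProbabilityMeasure_P : IsProbabilityMeasure P
  map_value : P.map (fun x => x.2.2) = Γ.μ

attribute [instance] Environment.isProbabilityMeasure_μ InfoStructure.isProbabilityMeasure_P

namespace InfoStructure

variable {Γ : Environment} {Ts Tb : Type} [MeasurableSpace Ts] [MeasurableSpace Tb]

/-- A distributional strategy of Seller: a joint law of `(t_s, p)` whose marginal on `Ts` is the
law of Seller's signal. -/
structure SellerStrategy (τ : InfoStructure Γ Ts Tb) where
  /-- the joint law of Seller's signal and the posted price -/
  law : Measure (Ts × ℝ)
  isProbabilityMeasure_law : IsProbabilityMeasure law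
  fst_law : law.fst = τ.P.map (fun x => x.1)

attribute [instance] SellerStrategy.isProbabilityMeasure_law

/-- A strategy of Buyer: the probability of accepting price `p` after signal `t_b`. -/
structure BuyerStrategy (Tb : Type) [MeasurableSpace Tb] where
  /-- the trading probability -/
  prob : ℝ × Tb → ℝ
  measurable_prob : Measurable prob
  prob_mem : ∀ x, prob x ∈ Set.Icc (0 : ℝ) 1

/-- `σ(· | t_s)`, the regular conditional distribution of the price given Seller's signal. -/
def SellerStrategy.priceKernel {τ : InfoStructure Γ Ts Tb} (σ : τ.SellerStrategy) :
    Kernel Ts ℝ :=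
  σ.law.condKernel

/-- The law `σ(dp | t_s) P(dt_s, dt_b, dv)` of `((t_s, t_b, v), p)`. -/
def outcome (τ : InfoStructure Γ Ts Tb) (σ : τ.SellerStrategy) :
    Measure ((Ts × Tb × Γ.V) × ℝ) :=
  τ.P ⊗ₘ σ.priceKernel.comap Prod.fst measurable_fst

/-- Buyer's expected utility from trade, `(v - p) α(p, t_b)`, at a realization. -/
def buyerUtility (α : BuyerStrategy Tb) (x : (Ts × Tb × Γ.V) × ℝ) : ℝ :=
  ((x.1.2.2 : ℝ) - x.2) * α.prob (x.2, x.1.2.1)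

/-- Seller's expected utility from trade, `(p - c(v)) α(p, t_b)`, at a realization. -/
def sellerUtility (α : BuyerStrategy Tb) (x : (Ts × Tb × Γ.V) × ℝ) : ℝ :=
  (x.2 - Γ.c x.1.2.2) * α.prob (x.2, x.1.2.1)

/-- Buyer's ex-ante payoff. -/
def buyerPayoff (τ : InfoStructure Γ Ts Tb) (σ : τ.SellerStrategy) (α : BuyerStrategy Tb) : ℝ :=
  ∫ x, buyerUtility α x ∂(τ.outcome σ)

/-- Seller's ex-ante payoff. -/
def sellerPayoff (τ : InfoStructure Γ Ts Tb) (σ : τ.SellerStrategy) (α : BuyerStrategy Tb) : ℝ :=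
  ∫ x, sellerUtility α x ∂(τ.outcome σ)

/-- The strategy profile `(σ, α)` with Buyer's beliefs `ν(· | p, t_b)` about the value is a weak
perfect Bayesian equilibrium.

On integrability: a Buyer who plays optimally rejects all prices above `max V`, so Seller's utility
is bounded above, and a strategy for which it is not integrable has expected payoff `-∞`. Hence only
strategies with integrable utility matter as deviations. Buyer's and Seller's utilities add up to a
bounded function, so that one is integrable when the other is. -/
structure IsWPBE (τ : InfoStructure Γ Ts Tb) (σ : τ.SellerStrategy) (α : BuyerStrategy Tb)
    (ν : Kernel (ℝ × Tb) Γ.V) : Prop where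
  /-- the beliefs are probability measures on `V` -/
  isMarkovKernel : IsMarkovKernel ν
  /-- Buyer accepts at every information set where he expects a gain -/
  accept : ∀ (p : ℝ) (t : Tb), p < ∫ v : Γ.V, (v : ℝ) ∂(ν (p, t)) → α.prob (p, t) = 1
  /-- Buyer rejects at every information set where he expects a loss -/
  reject : ∀ (p : ℝ) (t : Tb), ∫ v : Γ.V, (v : ℝ) ∂(ν (p, t)) < p → α.prob (p, t) = 0
  /-- Seller's payoff and Buyer's payoff are finite -/
  integrable_seller : Integrable (sellerUtility α) (τ.outcome σ)
  integrable_buyer : Integrable (buyerUtility α) (τ.outcome σ)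
  /-- Seller plays optimally -/
  seller_optimal : ∀ σ' : τ.SellerStrategy, Integrable (sellerUtility α) (τ.outcome σ') →
    τ.sellerPayoff σ' α ≤ τ.sellerPayoff σ α
  /-- Bayes' rule on path: `ν` is a conditional law of `v` given what Buyer observes, `(p, t_b)` -/
  bayes : (τ.outcome σ).map (fun x => (x.2, x.1.2.1)) ⊗ₘ ν =
    (τ.outcome σ).map (fun x => ((x.2, x.1.2.1), x.1.2.2))

/-- Price-independent beliefs: for every price `p`, on or off path, `ν(· | p, ·)` is a conditional
law of `v` given Buyer's signal alone. -/
def PriceIndependent (τ : InfoStructure Γ Ts Tb) (ν : Kernel (ℝ × Tb) Γ.V) : Prop :=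
  ∀ p : ℝ, τ.P.map (fun x => x.2.1) ⊗ₘ ν.comap (fun t => (p, t)) measurable_prodMk_left =
    τ.P.map (fun x => (x.2.1, x.2.2))

/-- `Π(Γ, τ)`: the payoff pairs `(π_b, π_s)` of weak perfect Bayesian equilibria. -/
def payoffSet (τ : InfoStructure Γ Ts Tb) : Set (ℝ × ℝ) :=
  {π | ∃ (σ : τ.SellerStrategy) (α : BuyerStrategy Tb) (ν : Kernel (ℝ × Tb) Γ.V),
    τ.IsWPBE σ α ν ∧ π = (τ.buyerPayoff σ α, τ.sellerPayoff σ α)}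

/-- `Π*(Γ, τ)`: the payoff pairs `(π_b, π_s)` of weak perfect Bayesian equilibria with
price-independent beliefs. -/
def payoffSetStar (τ : InfoStructure Γ Ts Tb) : Set (ℝ × ℝ) :=
  {π | ∃ (σ : τ.SellerStrategy) (α : BuyerStrategy Tb) (ν : Kernel (ℝ × Tb) Γ.V),
    τ.IsWPBE σ α ν ∧ τ.PriceIndependent ν ∧ π = (τ.buyerPayoff σ α, τ.sellerPayoff σ α)}

/-- Buyer is fully informed: `Tb = V`, and Buyer's signal equals the value almost surely. -/
def FullyInformedBuyer (τ : InfoStructure Γ Ts Γ.V) : Prop :=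
  ∀ᵐ x ∂τ.P, x.2.1 = x.2.2

end InfoStructure

namespace Environment

/-- All payoff pairs implementable under some information structure, the signal spaces being
arbitrary Polish spaces with their Borel sigma-algebras. -/
def implementable (Γ : Environment) : Set (ℝ × ℝ) :=
  {π | ∃ (Ts : Type) (_ : TopologicalSpace Ts) (_ : PolishSpace Ts)
    (_ : MeasurableSpace Ts) (_ : BorelSpace Ts)
    (Tb : Type) (_ : TopologicalSpace Tb) (_ : PolishSpace Tb)
    (_ : MeasurableSpace Tb) (_ : BorelSpace Tb)
    (τ : InfoStructure Γ Ts Tb), π ∈ τ.payoffSet}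

/-- The payoff pairs implementable with price-independent beliefs under some information structure
with fully informed Buyer. -/
def implementableFB (Γ : Environment) : Set (ℝ × ℝ) :=
  {π | ∃ (Ts : Type) (_ : TopologicalSpace Ts) (_ : PolishSpace Ts)
    (_ : MeasurableSpace Ts) (_ : BorelSpace Ts)
    (τ : InfoStructure Γ Ts Γ.V), τ.FullyInformedBuyer ∧ π ∈ τ.payoffSetStar}

/-- The profit that an uninformed Seller can guarantee against a fully informed Buyer,
`sup_p ∫_{v ≥ p} (p - c(v)) μ(dv)`. -/
def sellerGuaranteeFB (Γ : Environment) : ℝ :=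
  ⨆ p : ℝ, ∫ v in {v : Γ.V | p ≤ (v : ℝ)}, (p - Γ.c v) ∂Γ.μ

end Environment

end

/-!
Write `F(p) = ∫_{v ≥ p} (p - c(v)) μ(dv)`, `F* = sup F` and `W = ∫ (v - c(v)) μ(dv)`. Both sides of
the equality are the triangle `π_b ≥ 0`, `π_s ≥ F*`, `π_b + π_s ≤ W`.

*Necessity.* In every equilibrium Buyer accepts only when his expected gain is nonnegative, so that
`π_b ≥ 0`, and the sum of the payoffs is the surplus `v - c(v) ≥ 0` from the realized trades, at
most `W` (`IsWPBE.buyerPayoff_nonneg`, `IsWPBE.payoff_sum_le`). If a fully informed Buyer has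
price-independent beliefs, he accepts all prices below his value and rejects all prices above it,
also off path. Then a constant price just below `p` secures about `F(p)` for Seller, and
`π_s ≥ F*` (`IsWPBE.sellerGuaranteeFB_le`).

*Sufficiency.* Seller's signal is a pair of prices `(l, h)` with `l ≤ v ≤ h`, such that conditional
on the signal both `l` and `h` are optimal against a Buyer who knows `v`. At the price `l` trade is
efficient, at `h` Buyer has no surplus, and Seller earns the same. It remains to find such a
segmentation in which Seller earns no more than `F*`; a mixture with full revelation, where
`l = h = v`, gives her any profit between that and `W`, and mixing between `l` and `h` divides the
rest (`mem_implementableFB`).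

The segmentation is built from equal-revenue markets, in which all prices in the support earn the
same profit, so that its minimum and maximum can serve as `l` and `h`. A market with finitely many
values and costs below values splits into equal-revenue markets greedily, and Seller's total profit
is then that of a single price in the undivided market (`exists_equalRevenue_decomposition`).
Rounding the values of `μ` down to a grid of width `δ` and lowering costs by `2δ` gives
segmentations of `μ` that are optimal up to an error of order `δ`
(`exists_isSegmentation_approx`). Probability measures on a compact space are weakly compact, and a
limit point as `δ → 0` is an exact segmentation (`exists_isSegmentation`). To survive the limit,
optimality is formulated with continuous test functions. The conditional statement, for almost every
signal and all prices at once, is recovered by disintegration (`IsSegmentation.ae_profit_le_low`,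
`IsSegmentation.ae_profit_le_high`).
-/

open MeasureTheory ProbabilityTheory

noncomputable section

/-! ### Equal-revenue markets with finitely many values -/

/-- Seller's profit from the price `p` in a market with finitely many values: `m x` is the mass of
Buyers with value `x ∈ S`, and `C x` is the cost of serving them. -/
def finProfit (S : Finset ℝ) (C m : ℝ → ℝ) (p : ℝ) : ℝ :=
  ∑ x ∈ S, if p ≤ x then m x * (p - C x) else 0

/-- An equal-revenue market: a nonzero market with support `A ⊆ S` in which each price in the
support earns the same profit `k`. -/
structure IsEqualRevenue (S : Finset ℝ) (C m : ℝ → ℝ) (A : Finset ℝ) (k : ℝ) : Prop where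
  nonempty : A.Nonempty
  subset : A ⊆ S
  pos : ∀ x ∈ A, 0 < m x
  zero : ∀ x ∉ A, m x = 0
  profit_eq : ∀ x ∈ A, finProfit S C m x = k

lemma finProfit_add (S : Finset ℝ) (C m m' : ℝ → ℝ) (p : ℝ) :
    finProfit S C (fun x => m x + m' x) p = finProfit S C m p + finProfit S C m' p := by
  simp only [finProfit, ← Finset.sum_add_distrib]
  refine Finset.sum_congr rfl fun x _ => ?_
  split_ifs <;> ring

lemma finProfit_const_mul (S : Finset ℝ) (C m : ℝ → ℝ) (a p : ℝ) :
    finProfit S C (fun x => a * m x) p = a * finProfit S C m p := by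
  simp only [finProfit, Finset.mul_sum]
  refine Finset.sum_congr rfl fun x _ => ?_
  split_ifs <;> ring

lemma finProfit_eq_sum {S : Finset ℝ} {C m : ℝ → ℝ} {p : ℝ} (h : ∀ x, m x ≠ 0 → p ≤ x) :
    finProfit S C m p = ∑ x ∈ S, m x * (p - C x) := by
  refine Finset.sum_congr rfl fun x _ => ?_
  by_cases hx : m x = 0
  · simp [hx]
  · simp [h x hx]

namespace IsEqualRevenue

variable {S A : Finset ℝ} {C m : ℝ → ℝ} {k : ℝ}

lemma nonneg (h : IsEqualRevenue S C m A k) (x : ℝ) : 0 ≤ m x := by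
  by_cases hx : x ∈ A
  · exact (h.pos x hx).le
  · exact (h.zero x hx).ge

lemma mem_of_ne_zero (h : IsEqualRevenue S C m A k) {x : ℝ} (hx : m x ≠ 0) : x ∈ A :=
  not_imp_comm.1 (h.zero x) hx

lemma profit_nonneg (h : IsEqualRevenue S C m A k) (hC : ∀ x ∈ S, C x < x) : 0 ≤ k := by
  rw [← h.profit_eq _ (A.max'_mem h.nonempty)]
  refine Finset.sum_nonneg fun x hx => ?_
  split_ifs with hle
  · by_cases hm : m x = 0
    · simp [hm]
    · have : x ≤ A.max' h.nonempty := A.le_max' _ (h.mem_of_ne_zero hm)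
      exact mul_nonneg (h.nonneg x) (by linarith [hC x hx])
  · rfl

/-- In an equal-revenue market no price does better than those in the support: raising a price to
the next higher value of the support loses no Buyer. -/
lemma finProfit_le (h : IsEqualRevenue S C m A k) (hC : ∀ x ∈ S, C x < x) (p : ℝ) :
    finProfit S C m p ≤ k := by
  by_cases hB : (A.filter (p ≤ ·)).Nonempty
  · set y := (A.filter (p ≤ ·)).min' hB
    have hy := Finset.mem_filter.1 ((A.filter (p ≤ ·)).min'_mem hB)
    rw [← h.profit_eq y hy.1]
    refine Finset.sum_le_sum fun x hx => ?_
    by_cases hm : m x = 0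
    · simp [hm]
    · have hxA := h.mem_of_ne_zero hm
      by_cases hpx : p ≤ x
      · have hyx : y ≤ x := Finset.min'_le _ _ (Finset.mem_filter.2 ⟨hxA, hpx⟩)
        rw [if_pos hpx, if_pos hyx]
        have := h.nonneg x
        have := hy.2
        gcongr
      · have hyx : ¬ y ≤ x := fun hyx => hpx (hy.2.trans hyx)
        rw [if_neg hpx, if_neg hyx]
  · have : finProfit S C m p = 0 := by
      refine Finset.sum_eq_zero fun x hx => ?_
      split_ifs with hpx
      · by_cases hm : m x = 0
        · simp [hm]
        · exact absurd ⟨x, Finset.mem_filter.2 ⟨h.mem_of_ne_zero hm, hpx⟩⟩ hB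
      · rfl
    rw [this]
    exact h.profit_nonneg hC

lemma const_mul (h : IsEqualRevenue S C m A k) {a : ℝ} (ha : 0 < a) :
    IsEqualRevenue S C (fun x => a * m x) A (a * k) where
  nonempty := h.nonempty
  subset := h.subset
  pos x hx := mul_pos ha (h.pos x hx)
  zero x hx := by simp [h.zero x hx]
  profit_eq x hx := by rw [finProfit_const_mul, h.profit_eq x hx]

end IsEqualRevenue

/-- Every nonempty set of values is the support of an equal-revenue market. The masses are chosen
from the highest value downwards. -/
lemma exists_isEqualRevenue {S : Finset ℝ} {C : ℝ → ℝ} (hC : ∀ x ∈ S, C x < x) (A : Finset ℝ) :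
    A.Nonempty → A ⊆ S → ∃ m k, IsEqualRevenue S C m A k := by
  induction A using Finset.induction_on_min with
  | empty => simp
  | insert a s has ih =>
    intro _ hsub
    have haS : a ∈ S := hsub (Finset.mem_insert_self _ _)
    have has' : a ∉ s := fun h => lt_irrefl a (has a h)
    have hCa : 0 < a - C a := sub_pos.2 (hC a haS)
    have single (c p : ℝ) (hp : p ≤ a) :
        finProfit S C (fun x => if x = a then c else 0) p = c * (p - C a) := by
      rw [finProfit, Finset.sum_eq_single_of_mem a haS]
      · simp [hp]
      · intro x _ hx
        simp [hx]
    rcases s.eq_empty_or_nonempty with rfl | hs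
    · refine ⟨fun x => if x = a then 1 else 0, a - C a, ⟨by simp, hsub, by simp, ?_, ?_⟩⟩
      · intro x hx
        simpa using hx
      · intro x hx
        obtain rfl : x = a := by simpa using hx
        rw [single _ _ le_rfl, one_mul]
    · obtain ⟨m, k, h⟩ := ih hs ((Finset.subset_insert _ _).trans hsub)
      set b := s.min' hs
      have hb : b ∈ s := s.min'_mem hs
      have hk : k = ∑ x ∈ S, m x * (b - C x) := by
        rw [← h.profit_eq b hb, finProfit_eq_sum]
        exact fun x hx => s.min'_le _ (h.mem_of_ne_zero hx)
      -- the mass at `a` that makes `a` as profitable as the other prices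
      set c := (k - ∑ x ∈ S, m x * (a - C x)) / (a - C a) with hc
      have hcpos : 0 < c := by
        refine div_pos ?_ hCa
        have : k - ∑ x ∈ S, m x * (a - C x) = ∑ x ∈ S, m x * (b - a) := by
          rw [hk, ← Finset.sum_sub_distrib]
          exact Finset.sum_congr rfl fun x _ => by ring
        rw [this]
        have hba : 0 < b - a := sub_pos.2 (has b hb)
        refine Finset.sum_pos' (fun x _ => mul_nonneg (h.nonneg x) hba.le) ⟨b, h.subset hb, ?_⟩
        exact mul_pos (h.pos b hb) hba
      refine ⟨fun x => m x + if x = a then c else 0, k, ⟨by simp, hsub, ?_, ?_, ?_⟩⟩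
      · intro x hx
        rcases Finset.mem_insert.1 hx with rfl | hx
        · simpa [h.zero x has'] using hcpos
        · have : x ≠ a := fun e => has' (e ▸ hx)
          simpa [this] using h.pos x hx
      · intro x hx
        simp only [Finset.mem_insert, not_or] at hx
        simp [h.zero x hx.2, hx.1]
      · intro x hx
        rw [finProfit_add]
        rcases Finset.mem_insert.1 hx with rfl | hx
        · rw [single _ _ le_rfl, finProfit_eq_sum, hc, div_mul_cancel₀ _ hCa.ne']
          · ring
          · exact fun y hy => (has y (h.mem_of_ne_zero hy)).le
        · rw [h.profit_eq x hx]
          have : finProfit S C (fun y => if y = a then c else 0) x = 0 := by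
            refine Finset.sum_eq_zero fun y _ => ?_
            by_cases hy : y = a
            · have := has x hx
              rw [if_neg (by rw [hy]; linarith)]
            · simp [hy]
          rw [this, add_zero]

/-- A market with finitely many values splits into equal-revenue markets whose total profit is the
profit from a single price in the undivided market. As long as mass is left, the split removes the
largest possible multiple of the equal-revenue market with the same support. This lowers the profit
of every price in the support by the same amount, so that a price that stays in the support until
the end has earned the profits of all parts. -/
lemma exists_equalRevenue_decomposition {S : Finset ℝ} {C : ℝ → ℝ} (hC : ∀ x ∈ S, C x < x)
    (w : ℝ → ℝ) (B : Finset ℝ) (hB : B.Nonempty) (hBS : B ⊆ S) (hpos : ∀ x ∈ B, 0 < w x)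
    (hzero : ∀ x ∉ B, w x = 0) :
    ∃ (ι : Type) (_ : Fintype ι) (m : ι → ℝ → ℝ) (A : ι → Finset ℝ) (k : ι → ℝ),
      (∀ i, IsEqualRevenue S C (m i) (A i) (k i)) ∧ (∀ x, ∑ i, m i x = w x) ∧
      ∃ p ∈ B, ∑ i, k i = finProfit S C w p := by
  induction B using Finset.strongInduction generalizing w with
  | H B ih =>
    obtain ⟨m, k, h⟩ := exists_isEqualRevenue hC B hB hBS
    obtain ⟨y, hy, hmin⟩ := B.exists_min_image (fun x => w x / m x) hB
    set a := w y / m y with ha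
    have hapos : 0 < a := div_pos (hpos y hy) (h.pos y hy)
    set w' : ℝ → ℝ := fun x => w x - a * m x with hw'
    have hw'y : w' y = 0 := by
      simp only [hw', ha]
      rw [div_mul_cancel₀ _ (h.pos y hy).ne', sub_self]
    have hw'0 (x) (hx : x ∈ B) : 0 ≤ w' x :=
      sub_nonneg.2 ((le_div_iff₀ (h.pos x hx)).1 (hmin x hx))
    have hww' : w = fun x => a * m x + w' x := by
      ext x
      simp [hw']
    set B' := B.filter (fun x => w' x ≠ 0) with hB'def
    have hB'B : B' ⊂ B := by
      refine (Finset.filter_ssubset).2 ⟨y, hy, by simpa using hw'y⟩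
    have hz' (x) (hx : x ∉ B') : w' x = 0 := by
      by_cases hxB : x ∈ B
      · simpa [hB'def, hxB] using hx
      · simp [hw', hzero x hxB, h.zero x hxB]
    rcases B'.eq_empty_or_nonempty with he | hne
    · have hw'z : ∀ x, w' x = 0 := fun x => hz' x (by simp [he])
      refine ⟨Unit, inferInstance, fun _ x => a * m x, fun _ => B, fun _ => a * k,
        fun _ => h.const_mul hapos, fun x => ?_, y, hy, ?_⟩
      · simpa [hw'z] using (congrFun hww' x).symm
      · rw [show w = fun x => a * m x by rw [hww']; simp [hw'z], finProfit_const_mul,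
          h.profit_eq y hy]
        simp
    · obtain ⟨ι, _, m', A', k', h1, h2, p, hp, h3⟩ := ih B' hB'B w' hne
        (hB'B.subset.trans hBS)
        (fun x hx => (hw'0 x (hB'B.subset hx)).lt_of_ne' (Finset.mem_filter.1 hx).2) hz'
      refine ⟨Option ι, inferInstance, fun i => i.elim (fun x => a * m x) m',
        fun i => i.elim B A', fun i => i.elim (a * k) k', ?_, fun x => ?_, p,
        hB'B.subset hp, ?_⟩
      · rintro (_ | i)
        · exact h.const_mul hapos
        · exact h1 i
      · simp [Fintype.sum_option, h2, hw']
      · rw [Fintype.sum_option, hww', finProfit_add, finProfit_const_mul,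
          h.profit_eq p (hB'B.subset hp), ← h3]
        simp

/-! ### Discretizing the prior -/

/-- The largest multiple of the grid width `δ > 0` that is at most `v`. -/
def gridFloor (δ v : ℝ) : ℝ := δ * ⌊v / δ⌋

section gridFloor

variable {δ : ℝ}

lemma gridFloor_le (hδ : 0 < δ) (v : ℝ) : gridFloor δ v ≤ v := by
  have := Int.floor_le (v / δ)
  rw [le_div_iff₀ hδ] at this
  rw [gridFloor, mul_comm]
  exact this

lemma lt_gridFloor_add (hδ : 0 < δ) (v : ℝ) : v < gridFloor δ v + δ := by
  have := Int.lt_floor_add_one (v / δ)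
  rw [div_lt_iff₀ hδ] at this
  rw [gridFloor]
  linarith

lemma gridFloor_mono (hδ : 0 < δ) : Monotone (gridFloor δ) := by
  intro a b hab
  unfold gridFloor
  gcongr

lemma gridFloor_gridFloor (hδ : 0 < δ) (v : ℝ) : gridFloor δ (gridFloor δ v) = gridFloor δ v := by
  simp [gridFloor, mul_div_cancel_left₀ _ hδ.ne']

lemma measurable_comp_gridFloor (δ : ℝ) (f : ℝ → ℝ) : Measurable fun v => f (gridFloor δ v) := by
  have h : Measurable fun n : ℤ => f (δ * n) := measurable_from_top
  exact h.comp (Int.measurable_floor.comp (measurable_id.div_const δ))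

end gridFloor

namespace Environment

variable (Γ : Environment)

instance : CompactSpace Γ.V := isCompact_iff_compactSpace.1 Γ.isCompact_V

instance : Nonempty Γ.V := Γ.nontrivial_V.nonempty.to_subtype

instance : PolishSpace Γ.V := Γ.isCompact_V.isClosed.polishSpace

lemma exists_bound : ∃ M : ℝ, ∀ v : Γ.V, |(v : ℝ)| ≤ M ∧ |Γ.c v| ≤ M := by
  obtain ⟨M₁, h₁⟩ := (isCompact_range
    (continuous_subtype_val (p := (· ∈ Γ.V)))).isBounded.exists_norm_le
  obtain ⟨M₂, h₂⟩ := (isCompact_range Γ.continuous_c).isBounded.exists_norm_le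
  exact ⟨max M₁ M₂, fun v => ⟨(h₁ _ ⟨v, rfl⟩).trans (le_max_left _ _),
    (h₂ _ ⟨v, rfl⟩).trans (le_max_right _ _)⟩⟩

/-- The values in the grid cell that starts at `x`. -/
def cell (δ x : ℝ) : Set Γ.V := {v | gridFloor δ v = x}

/-- The prior mass of a grid cell. -/
def cellMass (δ x : ℝ) : ℝ := Γ.μ.real (Γ.cell δ x)

/-- The mean cost in a grid cell, lowered by `2 * δ`, so that it is below every value of the cell
and below the start of the cell. -/
def cellCost (δ x : ℝ) : ℝ := (∫ v in Γ.cell δ x, (Γ.c v - 2 * δ) ∂Γ.μ) / Γ.cellMass δ x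

variable {Γ} {δ : ℝ}

lemma measurableSet_cell (x : ℝ) : MeasurableSet (Γ.cell δ x) :=
  ((measurable_comp_gridFloor δ id).comp measurable_subtype_coe) (measurableSet_singleton x)

lemma measurable_c : Measurable Γ.c := Γ.continuous_c.measurable

lemma integrable_of_bound {f : Γ.V → ℝ} (hf : Measurable f) {B : ℝ} (hB : ∀ v, |f v| ≤ B) :
    Integrable f Γ.μ :=
  .of_bound hf.aestronglyMeasurable B (.of_forall hB)

lemma integrable_c : Integrable Γ.c Γ.μ := by
  obtain ⟨M, hM⟩ := Γ.exists_bound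
  exact integrable_of_bound measurable_c fun v => (hM v).2

lemma integrable_coe : Integrable (fun v : Γ.V => (v : ℝ)) Γ.μ := by
  obtain ⟨M, hM⟩ := Γ.exists_bound
  exact integrable_of_bound measurable_subtype_coe fun v => (hM v).1

lemma cellMass_nonneg (x : ℝ) : 0 ≤ Γ.cellMass δ x := measureReal_nonneg

lemma cellCost_lt (hδ : 0 < δ) {x : ℝ} (hx : 0 < Γ.cellMass δ x) : Γ.cellCost δ x < x := by
  rw [cellCost, div_lt_iff₀ hx]
  have h : ∫ v in Γ.cell δ x, (Γ.c v - 2 * δ) ∂Γ.μ ≤ ∫ _ in Γ.cell δ x, (x - δ) ∂Γ.μ := by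
    refine setIntegral_mono_on (integrable_c.sub (integrable_const _)).integrableOn
      (integrable_const _).integrableOn (measurableSet_cell x) fun v hv => ?_
    have h1 := lt_gridFloor_add hδ (v : ℝ)
    have h2 := Γ.c_le v
    have h3 : gridFloor δ v = x := hv
    linarith
  rw [setIntegral_const, smul_eq_mul] at h
  change _ ≤ Γ.cellMass δ x * _ at h
  nlinarith

/-- Only finitely many grid cells have positive prior mass. -/
lemma exists_finset_cellMass_pos (Γ : Environment) (δ : ℝ) :
    ∃ S : Finset ℝ, ∀ x, x ∈ S ↔ 0 < Γ.cellMass δ x := by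
  obtain ⟨M, hM⟩ := Γ.exists_bound
  have hfin : {x | 0 < Γ.cellMass δ x}.Finite := by
    refine ((Set.finite_Icc (-⌈M / |δ|⌉ - 1) (⌈M / |δ|⌉ + 1)).image fun n : ℤ => δ * n).subset ?_
    intro x hx
    obtain ⟨v, hv⟩ : (Γ.cell δ x).Nonempty := by
      by_contra h
      rw [Set.not_nonempty_iff_eq_empty] at h
      simp [cellMass, h] at hx
    refine ⟨⌊(v : ℝ) / δ⌋, ?_, hv⟩
    have h1 : |(v : ℝ) / δ| ≤ ⌈M / |δ|⌉ := by
      rw [abs_div]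
      exact (div_le_div_of_nonneg_right (hM v).1 (abs_nonneg δ)).trans (Int.le_ceil _)
    have h2 := Int.floor_le ((v : ℝ) / δ)
    have h3 := Int.lt_floor_add_one ((v : ℝ) / δ)
    rw [abs_le] at h1
    constructor
    · have : -(⌈M / |δ|⌉ : ℝ) < ⌊(v : ℝ) / δ⌋ + 1 := by linarith
      have : -⌈M / |δ|⌉ < ⌊(v : ℝ) / δ⌋ + 1 := by exact_mod_cast this
      omega
    · have : (⌊(v : ℝ) / δ⌋ : ℝ) ≤ ⌈M / |δ|⌉ := by linarith
      have : ⌊(v : ℝ) / δ⌋ ≤ ⌈M / |δ|⌉ := by exact_mod_cast this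
      omega
  exact ⟨hfin.toFinset, by simp⟩

lemma ae_cellMass_pos (Γ : Environment) (δ : ℝ) :
    ∀ᵐ v : Γ.V ∂Γ.μ, 0 < Γ.cellMass δ (gridFloor δ v) := by
  have h : ∀ n : ℤ, ∀ᵐ v : Γ.V ∂Γ.μ, ¬ (gridFloor δ v = δ * n ∧ ¬ 0 < Γ.cellMass δ (δ * n)) := by
    intro n
    by_cases hn : 0 < Γ.cellMass δ (δ * n)
    · simp [hn]
    · have h0 : Γ.μ (Γ.cell δ (δ * n)) = 0 := by
        have : Γ.μ.real (Γ.cell δ (δ * n)) = 0 := le_antisymm (not_lt.1 hn) measureReal_nonneg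
        exact (measureReal_eq_zero_iff).1 this
      filter_upwards [measure_eq_zero_iff_ae_notMem.1 h0] with v hv hv'
      exact hv hv'.1
  filter_upwards [ae_all_iff.2 h] with v hv
  by_contra hc
  exact hv ⌊(v : ℝ) / δ⌋ ⟨rfl, hc⟩

/-- The profit in a market with finitely many values, whose mass `m x` at `x` is spread over the
grid cell of `x` in proportion to the prior, is an integral over the values. -/
lemma finProfit_eq_integral {S : Finset ℝ} (hS : ∀ x, x ∈ S ↔ 0 < Γ.cellMass δ x)
    (m : ℝ → ℝ) (p : ℝ) :
    finProfit S (Γ.cellCost δ) m p =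
      ∫ v : Γ.V, m (gridFloor δ v) / Γ.cellMass δ (gridFloor δ v) *
        (if p ≤ gridFloor δ v then p - Γ.c v + 2 * δ else 0) ∂Γ.μ := by
  have h : ∀ v : Γ.V, m (gridFloor δ v) / Γ.cellMass δ (gridFloor δ v) *
      (if p ≤ gridFloor δ v then p - Γ.c v + 2 * δ else 0) =
      ∑ x ∈ S, (Γ.cell δ x).indicator (fun v => if p ≤ x then
        m x / Γ.cellMass δ x * (p - (Γ.c v - 2 * δ)) else 0) v := by
    intro v
    by_cases hv : gridFloor δ v ∈ S
    · rw [Finset.sum_eq_single_of_mem _ hv]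
      · rw [Set.indicator_of_mem (by exact rfl)]
        split_ifs <;> ring
      · intro x _ hx
        exact Set.indicator_of_notMem (fun h => hx h.symm) _
    · have h0 : Γ.cellMass δ (gridFloor δ v) = 0 :=
        le_antisymm (not_lt.1 (mt (hS _).2 hv)) (cellMass_nonneg _)
      rw [h0, div_zero, zero_mul, Finset.sum_eq_zero]
      intro x hx
      exact Set.indicator_of_notMem
        (fun h => hv (by rw [show gridFloor δ v = x from h]; exact hx)) _
  simp_rw [h]
  have hint (x : ℝ) : Integrable (fun v => if p ≤ x then
      m x / Γ.cellMass δ x * (p - (Γ.c v - 2 * δ)) else 0) Γ.μ := by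
    split_ifs
    · exact ((integrable_const _).sub (integrable_c.sub (integrable_const _))).const_mul _
    · exact integrable_zero _ _ _
  rw [integral_finsetSum _ fun x _ => (hint x).indicator (measurableSet_cell x)]
  refine Finset.sum_congr rfl fun x hx => ?_
  rw [integral_indicator (measurableSet_cell x)]
  split_ifs
  · rw [integral_const_mul, integral_sub (integrable_const _)
      (g := fun v => Γ.c v - 2 * δ) (integrable_c.sub (integrable_const _)).integrableOn,
      setIntegral_const, smul_eq_mul]
    have hx' := (hS x).1 hx
    change _ = m x / Γ.cellMass δ x * (Γ.cellMass δ x * p - _)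
    rw [cellCost]
    field_simp
  · simp

/-- Seller's profit from the price `p` in the market `m`, when all values `v ≥ p` accept. -/
def profit (Γ : Environment) (m : Measure Γ.V) (p : ℝ) : ℝ :=
  ∫ v in {v : Γ.V | p ≤ (v : ℝ)}, (p - Γ.c v) ∂m

lemma measurableSet_le_coe (p : ℝ) : MeasurableSet {v : Γ.V | p ≤ (v : ℝ)} :=
  measurable_subtype_coe measurableSet_Ici

lemma profit_le_surplus (Γ : Environment) (p : ℝ) :
    Γ.profit Γ.μ p ≤ ∫ v : Γ.V, ((v : ℝ) - Γ.c v) ∂Γ.μ := by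
  rw [profit, ← integral_indicator (measurableSet_le_coe p)]
  refine integral_mono (((integrable_const _).sub integrable_c).indicator (measurableSet_le_coe p))
    (integrable_coe.sub integrable_c) fun v => ?_
  simp only [Set.indicator_apply, Set.mem_ofPred_eq]
  have := Γ.c_le v
  split_ifs <;> linarith

lemma profit_le_sellerGuaranteeFB (Γ : Environment) (p : ℝ) :
    Γ.profit Γ.μ p ≤ Γ.sellerGuaranteeFB :=
  le_ciSup (f := Γ.profit Γ.μ) ⟨_, Set.forall_mem_range.2 Γ.profit_le_surplus⟩ p

end Environment

/-! ### Segmentations that are optimal up to an error -/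

/-- The continuous function that is `0` up to `q`, `1` from `p` on, and affine in between. -/
def ramp (q p v : ℝ) : ℝ := max 0 (min 1 ((v - q) / (p - q)))

section ramp

variable {q p v : ℝ}

lemma ramp_nonneg : 0 ≤ ramp q p v := le_max_left _ _

lemma ramp_le_one : ramp q p v ≤ 1 := max_le zero_le_one (min_le_left _ _)

lemma ramp_of_le (hqp : q < p) (hv : v ≤ q) : ramp q p v = 0 :=
  max_eq_left ((min_le_right _ _).trans
    (div_nonpos_of_nonpos_of_nonneg (by linarith) (by linarith)))

lemma ramp_of_ge (hqp : q < p) (hv : p ≤ v) : ramp q p v = 1 := by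
  have : 1 ≤ (v - q) / (p - q) := by
    rw [le_div_iff₀ (by linarith)]
    linarith
  rw [ramp, min_eq_left this, max_eq_right zero_le_one]

@[fun_prop]
lemma continuous_ramp : Continuous (ramp q p) := by
  unfold ramp
  fun_prop

end ramp

/-- Pairs of prices in a bounded interval, used as Seller's signals: the pair `(l, h)` announces
that the value is between `l` and `h`. -/
abbrev PricePair (R : ℝ) : Type := Set.Icc (-R) R × Set.Icc (-R) R

namespace Environment

variable (Γ : Environment)

/-- Seller's utility from the price `q` when values from `p` on buy and values between `q` and `p`
buy with a probability that makes the utility continuous in the value. -/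
def smoothGain (q p : ℝ) (v : Γ.V) : ℝ := ramp q p v * (q - Γ.c v)

/-- Seller's utility if the price is `h` and the values in an interval of length `κ` below `h` buy,
smoothed to be continuous. -/
def smoothTopGain (κ : ℝ) (h : ℝ) (v : Γ.V) : ℝ := (1 - ramp κ (2 * κ) (h - v)) * (h - Γ.c v)

/-- The gain, up to the smoothing error `p - q`, from the price `q` over the price `l` that all
values of the segment `(l, h)` accept. -/
def lowGain {R : ℝ} (q p : ℝ) (x : PricePair R × Γ.V) : ℝ :=
  Γ.smoothGain q p x.2 - (p - q) - (x.1.1 - Γ.c x.2)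

/-- The gain, up to smoothing errors, from the price `q` over the price `h` that only the highest
values of the segment `(l, h)` accept. -/
def highGain {R : ℝ} (κ q p : ℝ) (x : PricePair R × Γ.V) : ℝ :=
  Γ.smoothGain q p x.2 - (p - q) - Γ.smoothTopGain κ x.1.2 x.2

/-- A segmentation of the prior: a joint law of a price pair `(l, h)` and the value `v`, such that
`l ≤ v ≤ h` and both prices `l` and `h` are optimal given the pair, up to an error `δ`. Optimality
is stated with continuous test functions `H` of the pair and smoothed gains, so that it is preserved
by weak limits. In `high` the smoothing width `κ` is at least the error `δ`, because in an
approximate segmentation the highest values of a segment may be below `h` by `δ`. -/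
structure IsSegmentation (R δ : ℝ) (η : Measure (PricePair R × Γ.V)) : Prop where
  map_snd : η.map Prod.snd = Γ.μ
  between : ∀ᵐ x ∂η, (x.1.1 : ℝ) ≤ x.2 ∧ (x.2 : ℝ) ≤ x.1.2
  low : ∀ H : C(PricePair R, ℝ), (∀ t, 0 ≤ H t) → ∀ q p, q < p →
    ∫ x, H x.1 * Γ.lowGain q p x ∂η ≤ 2 * δ * ∫ x, H x.1 ∂η
  high : ∀ H : C(PricePair R, ℝ), (∀ t, 0 ≤ H t) → ∀ κ, 0 < κ → δ ≤ κ → ∀ q p, q < p →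
    ∫ x, H x.1 * Γ.highGain κ q p x ∂η ≤ 2 * δ * ∫ x, H x.1 ∂η

variable {Γ}

@[fun_prop]
lemma continuous_smoothGain (q p : ℝ) : Continuous (Γ.smoothGain q p) := by
  have := Γ.continuous_c
  unfold smoothGain
  fun_prop

@[fun_prop]
lemma continuous_lowGain {R : ℝ} (q p : ℝ) :
    Continuous (Γ.lowGain q p : PricePair R × Γ.V → ℝ) := by
  have := Γ.continuous_c
  unfold lowGain
  fun_prop

@[fun_prop]
lemma continuous_highGain {R : ℝ} (κ q p : ℝ) :
    Continuous (Γ.highGain κ q p : PricePair R × Γ.V → ℝ) := by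
  have := Γ.continuous_c
  unfold highGain smoothTopGain
  fun_prop

lemma IsSegmentation.isProbabilityMeasure {R δ : ℝ} {η : Measure (PricePair R × Γ.V)}
    (h : Γ.IsSegmentation R δ η) : IsProbabilityMeasure η := by
  have : IsProbabilityMeasure (η.map Prod.snd) := h.map_snd ▸ inferInstance
  exact Measure.isProbabilityMeasure_of_map Prod.snd

lemma _root_.Continuous.integrable_of_compactSpace {X : Type*} [TopologicalSpace X]
    [CompactSpace X] [MeasurableSpace X] [OpensMeasurableSpace X] {μ : Measure X}
    [IsFiniteMeasure μ] {f : X → ℝ} (hf : Continuous f) : Integrable f μ :=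
  hf.integrable_of_hasCompactSupport (HasCompactSupport.of_compactSpace f)

lemma smoothGain_le {q p : ℝ} (hqp : q < p) (v : Γ.V) :
    Γ.smoothGain q p v ≤ (if q ≤ (v : ℝ) then q - Γ.c v else 0) + (p - q) := by
  have hc := Γ.c_le v
  unfold smoothGain
  split_ifs with hqv
  · rcases le_total p (v : ℝ) with hpv | hpv
    · rw [ramp_of_ge hqp hpv]
      linarith
    · have h0 := ramp_nonneg (q := q) (p := p) (v := v)
      have h1 := ramp_le_one (q := q) (p := p) (v := v)
      rcases le_total 0 (q - Γ.c v) with h | h <;> nlinarith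
  · rw [ramp_of_le hqp (not_le.1 hqv).le]
    linarith

lemma le_smoothGain {q p' p : ℝ} (hqp' : q < p') (hp' : p' ≤ p) (v : Γ.V) :
    (if p ≤ (v : ℝ) then p - Γ.c v else 0) ≤ Γ.smoothGain q p' v + (p - q) := by
  have hc := Γ.c_le v
  unfold smoothGain
  split_ifs with hpv
  · rw [ramp_of_ge hqp' (hp'.trans hpv)]
    linarith
  · rcases le_total (v : ℝ) q with hqv | hqv
    · rw [ramp_of_le hqp' hqv]
      linarith
    · have h0 := ramp_nonneg (q := q) (p := p') (v := v)
      have h1 := ramp_le_one (q := q) (p := p') (v := v)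
      rcases le_total 0 (q - Γ.c v) with h | h <;> nlinarith

/-- Rounding prices and values down to the grid, while lowering costs by `2 * δ`, does not lower
Seller's utility. -/
lemma ite_le_ite_gridFloor {δ : ℝ} (hδ : 0 < δ) (q : ℝ) (v : Γ.V) :
    (if q ≤ (v : ℝ) then q - Γ.c v else 0) ≤
      if gridFloor δ q ≤ gridFloor δ v then gridFloor δ q - Γ.c v + 2 * δ else 0 := by
  have hc := Γ.c_le v
  have h1 := lt_gridFloor_add hδ q
  by_cases hqv : q ≤ (v : ℝ)
  · rw [if_pos hqv, if_pos (gridFloor_mono hδ hqv)]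
    linarith
  · rw [if_neg hqv]
    split_ifs
    · linarith
    · rfl

lemma smoothTopGain_nonneg {κ h : ℝ} {v : Γ.V} (hv : (v : ℝ) ≤ h) :
    0 ≤ Γ.smoothTopGain κ h v :=
  mul_nonneg (sub_nonneg.2 ramp_le_one) (by linarith [Γ.c_le v])

lemma measurableSet_between {R : ℝ} : MeasurableSet {x : PricePair R × Γ.V |
    (x.1.1 : ℝ) ≤ x.2 ∧ (x.2 : ℝ) ≤ x.1.2} := by
  have h₁ : MeasurableSet {x : PricePair R × Γ.V | (x.1.1 : ℝ) ≤ x.2} :=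
    measurableSet_le (by fun_prop) (by fun_prop)
  have h₂ : MeasurableSet {x : PricePair R × Γ.V | (x.2 : ℝ) ≤ x.1.2} :=
    measurableSet_le (by fun_prop) (by fun_prop)
  exact h₁.inter h₂

set_option maxHeartbeats 1000000 in
/-- The prior has approximate segmentations whose profit exceeds that of an uninformed Seller
only slightly: on a fine grid the prior decomposes into equal-revenue markets. In each of
them the lowest and the highest price of the support are both optimal. -/
lemma exists_isSegmentation_approx {M δ : ℝ} (hM : ∀ v : Γ.V, |(v : ℝ)| ≤ M) (hδ : 0 < δ)
    (hδ1 : δ ≤ 1) :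
    ∃ η : Measure (PricePair (M + 1) × Γ.V), Γ.IsSegmentation (M + 1) δ η ∧
      ∫ x, ((x.1.1 : ℝ) - Γ.c x.2) ∂η ≤ Γ.sellerGuaranteeFB + 2 * δ := by
  obtain ⟨S, hS⟩ := exists_finset_cellMass_pos Γ δ
  have hSv (x) (hx : x ∈ S) : ∃ v : Γ.V, gridFloor δ v = x := by
    by_contra! h
    have : Γ.cell δ x = ∅ := Set.eq_empty_of_forall_notMem h
    have h' := (hS x).1 hx
    simp [cellMass, this] at h'
  have hSne : S.Nonempty := by
    obtain ⟨v, hv⟩ := (ae_cellMass_pos Γ δ).exists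
    exact ⟨_, (hS _).2 hv⟩
  have hC : ∀ x ∈ S, Γ.cellCost δ x < x := fun x hx => cellCost_lt hδ ((hS x).1 hx)
  set w := Γ.cellMass δ with hw
  obtain ⟨ι, _, m, A, k, hm, hsum, p₀, hp₀, hk⟩ := exists_equalRevenue_decomposition hC w S hSne
    subset_rfl (fun x hx => (hS x).1 hx)
    (fun x hx => le_antisymm (not_lt.1 (mt (hS x).2 hx)) (cellMass_nonneg x))
  -- the share of the value `v` that goes to the segment `i`
  set D : ι → Γ.V → ℝ := fun i v => m i (gridFloor δ v) / w (gridFloor δ v) with hD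
  have hDm (i) : Measurable (D i) :=
    (measurable_comp_gridFloor δ (fun x => m i x / w x)).comp measurable_subtype_coe
  have hD0 (i) (v) : 0 ≤ D i v := div_nonneg ((hm i).nonneg _) (cellMass_nonneg _)
  have hD1 (i) (v) : D i v ≤ 1 := by
    refine div_le_one_of_le₀ ?_ (cellMass_nonneg _)
    rw [← hsum]
    exact Finset.single_le_sum (fun j _ => (hm j).nonneg _) (Finset.mem_univ i)
  have hDA (i) (v) (h : D i v ≠ 0) : gridFloor δ v ∈ A i :=
    (hm i).mem_of_ne_zero fun h0 => h (by simp [hD, h0])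
  -- the lowest and the highest grid point of each segment
  have hl (i) := (A i).min'_mem (hm i).nonempty
  have hh (i) := (A i).max'_mem (hm i).nonempty
  set l : ι → ℝ := fun i => (A i).min' (hm i).nonempty
  set h : ι → ℝ := fun i => (A i).max' (hm i).nonempty
  have hlI (i) : l i ∈ Set.Icc (-(M + 1)) (M + 1) := by
    obtain ⟨v, hv⟩ := hSv _ ((hm i).subset (hl i))
    have h1 := gridFloor_le hδ (v : ℝ)
    have h2 := lt_gridFloor_add hδ (v : ℝ)
    have h3 := abs_le.1 (hM v)
    rw [hv] at h1 h2
    constructor <;> linarith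
  have hhI (i) : h i + δ ∈ Set.Icc (-(M + 1)) (M + 1) := by
    obtain ⟨v, hv⟩ := hSv _ ((hm i).subset (hh i))
    have h1 := gridFloor_le hδ (v : ℝ)
    have h2 := lt_gridFloor_add hδ (v : ℝ)
    have h3 := abs_le.1 (hM v)
    rw [hv] at h1 h2
    constructor <;> linarith
  -- the value exceeds its grid point by up to `δ`, hence the shift of the upper price
  set t : ι → PricePair (M + 1) := fun i => (⟨l i, hlI i⟩, ⟨h i + δ, hhI i⟩)
  set η : Measure (PricePair (M + 1) × Γ.V) :=
    ∑ i, (Γ.μ.withDensity fun v => ENNReal.ofReal (D i v)).map (Prod.mk (t i)) with hη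
  have hmap_snd : η.map Prod.snd = Γ.μ := by
    ext s hs
    rw [Measure.map_apply measurable_snd hs, hη, Measure.finsetSum_apply]
    have : ∀ i, (Γ.μ.withDensity fun v => ENNReal.ofReal (D i v)).map (Prod.mk (t i))
        (Prod.snd ⁻¹' s) = ∫⁻ v in s, ENNReal.ofReal (D i v) ∂Γ.μ := fun i => by
      rw [Measure.map_apply measurable_prodMk_left (measurable_snd hs), ← withDensity_apply _ hs]
      rfl
    simp_rw [this]
    rw [← lintegral_finsetSum _ fun i _ => (hDm i).ennreal_ofReal, ← setLIntegral_one]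
    refine lintegral_congr_ae (ae_restrict_of_ae ?_)
    filter_upwards [ae_cellMass_pos Γ δ] with v hv
    rw [← ENNReal.ofReal_sum_of_nonneg fun i _ => hD0 i v, ← Finset.sum_div, hsum,
      div_self hv.ne', ENNReal.ofReal_one]
  have : IsProbabilityMeasure (η.map Prod.snd) := hmap_snd ▸ inferInstance
  have : IsProbabilityMeasure η := Measure.isProbabilityMeasure_of_map Prod.snd
  have hDint (i) {f : Γ.V → ℝ} (hf : Integrable f Γ.μ) : Integrable (fun v => D i v * f v) Γ.μ :=
    hf.bdd_mul (c := 1) (hDm i).aestronglyMeasurable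
      (.of_forall fun v => by rw [Real.norm_of_nonneg (hD0 i v)]; exact hD1 i v)
  have hint {f : PricePair (M + 1) × Γ.V → ℝ} (hf : Continuous f) :
      ∫ x, f x ∂η = ∑ i, ∫ v, D i v * f (t i, v) ∂Γ.μ := by
    have hfi : Integrable f η := hf.integrable_of_compactSpace
    rw [hη, integral_finsetSum_measure
      fun i hi => hfi.mono_measure (hη ▸ Finset.single_le_sum (f := fun i =>
        (Γ.μ.withDensity fun v => ENNReal.ofReal (D i v)).map (Prod.mk (t i)))
        (fun _ _ => bot_le) hi)]
    refine Finset.sum_congr rfl fun i _ => ?_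
    rw [integral_map measurable_prodMk_left.aemeasurable hf.aestronglyMeasurable,
      integral_withDensity_eq_integral_toReal_smul (hDm i).ennreal_ofReal
        (.of_forall fun _ => ENNReal.ofReal_lt_top)]
    simp_rw [ENNReal.toReal_ofReal (hD0 i _), smul_eq_mul]
  -- the profit of a grid price in a segment
  set G : ℝ → Γ.V → ℝ := fun p v => if p ≤ gridFloor δ v then p - Γ.c v + 2 * δ else 0 with hG
  have hGint (p : ℝ) : Integrable (G p) Γ.μ :=
    (((integrable_const p).sub integrable_c).add (integrable_const (2 * δ))).indicator
      (((measurable_comp_gridFloor δ id).comp measurable_subtype_coe) measurableSet_Ici)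
  have hGk (i) (p : ℝ) : ∫ v, D i v * G p v ∂Γ.μ ≤ k i := by
    rw [← finProfit_eq_integral hS]
    exact (hm i).finProfit_le hC p
  have hGk' (i) {p : ℝ} (hp : p ∈ A i) : ∫ v, D i v * G p v ∂Γ.μ = k i := by
    rw [← finProfit_eq_integral hS]
    exact (hm i).profit_eq p hp
  have key {f : PricePair (M + 1) × Γ.V → ℝ} (hf : Continuous f) (q : ℝ) (a : ι → ℝ)
      (ha : ∀ i, a i ∈ A i)
      (hle : ∀ i v, D i v ≠ 0 → f (t i, v) ≤ G q v - G (a i) v + 2 * δ)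
      (H : C(PricePair (M + 1), ℝ)) (hH : ∀ t, 0 ≤ H t) :
      ∫ x, H x.1 * f x ∂η ≤ 2 * δ * ∫ x, H x.1 ∂η := by
    rw [hint (by fun_prop), hint (by fun_prop), Finset.mul_sum]
    refine Finset.sum_le_sum fun i _ => ?_
    simp only
    have e1 : ∫ v, D i v * (H (t i) * f (t i, v)) ∂Γ.μ =
        H (t i) * ∫ v, D i v * f (t i, v) ∂Γ.μ := by
      rw [← integral_const_mul]
      exact integral_congr_ae (.of_forall fun v => by ring)
    have e2 : ∫ v, D i v * f (t i, v) ∂Γ.μ ≤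
        ∫ v, (D i v * G q v - D i v * G (a i) v + D i v * (2 * δ)) ∂Γ.μ := by
      refine integral_mono (hDint i (Continuous.integrable_of_compactSpace (by fun_prop)))
        (((hDint i (hGint q)).sub (hDint i (hGint _))).add (hDint i (integrable_const _)))
        fun v => ?_
      by_cases hv : D i v = 0
      · simp [hv]
      · have := mul_le_mul_of_nonneg_left (hle i v hv) (hD0 i v)
        simp only
        linarith
    have hsub : Integrable (fun v => D i v * G q v - D i v * G (a i) v) Γ.μ :=
      (hDint i (hGint q)).sub (hDint i (hGint _))
    rw [integral_add hsub (hDint i (integrable_const _)),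
      integral_sub (hDint i (hGint q)) (hDint i (hGint _)),
      hGk' i (ha i), integral_mul_const] at e2
    rw [e1, integral_mul_const]
    have e3 := mul_le_mul_of_nonneg_left (e2.trans (b := _) (c := (∫ v, D i v ∂Γ.μ) * (2 * δ))
      (by linarith [hGk i q])) (hH (t i))
    linarith
  have hGl (i) (v) (hv : D i v ≠ 0) : G (l i) v = l i - Γ.c v + 2 * δ :=
    if_pos ((A i).min'_le _ (hDA i v hv))
  refine ⟨η, ⟨hmap_snd, ?_, ?_, ?_⟩, ?_⟩
  · rw [hη, ae_finsetSum_measure_iff]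
    intro i _
    have hms : MeasurableSet {x : PricePair (M + 1) × Γ.V |
        (x.1.1 : ℝ) ≤ x.2 ∧ (x.2 : ℝ) ≤ x.1.2} := measurableSet_between
    rw [ae_map_iff measurable_prodMk_left.aemeasurable hms,
      ae_withDensity_iff (hDm i).ennreal_ofReal]
    refine .of_forall fun v hv => ?_
    have hv' : D i v ≠ 0 := fun h0 => hv (by simp [h0])
    have h1 : l i ≤ gridFloor δ v := (A i).min'_le _ (hDA i v hv')
    have h2 : gridFloor δ v ≤ h i := (A i).le_max' _ (hDA i v hv')
    have h3 := gridFloor_le hδ (v : ℝ)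
    have h4 := lt_gridFloor_add hδ (v : ℝ)
    exact ⟨h1.trans h3, by simp only [t]; linarith⟩
  · intro H hH q p hqp
    refine key (by fun_prop) (gridFloor δ q) l hl (fun i v hv => ?_) H hH
    rw [hGl i v hv]
    have h1 := smoothGain_le hqp v
    have h2 := ite_le_ite_gridFloor hδ q v
    simp only [lowGain, t, hG]
    linarith
  · intro H hH κ hκ hδκ q p hqp
    refine key (by fun_prop) (gridFloor δ q) h hh (fun i v hv => ?_) H hH
    have h1 := smoothGain_le hqp v
    have h2 := ite_le_ite_gridFloor hδ q v
    have h3 : G (h i) v ≤ Γ.smoothTopGain κ (h i + δ) v + 2 * δ := by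
      have h4 : gridFloor δ v ≤ h i := (A i).le_max' _ (hDA i v hv)
      have h5 := lt_gridFloor_add hδ (v : ℝ)
      have h6 := smoothTopGain_nonneg (κ := κ) (h := h i + δ) (v := v) (by linarith)
      simp only [hG]
      split_ifs with hhv
      · have h7 := gridFloor_le hδ (v : ℝ)
        rw [smoothTopGain, ramp_of_le (by linarith) (by linarith)]
        linarith
      · linarith
    simp only [highGain, t]
    simp only [hG] at h3 ⊢
    linarith
  · have hc := Γ.continuous_c
    have hind : Integrable ({v : Γ.V | p₀ ≤ (v : ℝ)}.indicator fun v => p₀ - Γ.c v) Γ.μ :=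
      ((integrable_const _).sub integrable_c).indicator (measurableSet_le_coe p₀)
    rw [hint (by fun_prop)]
    calc ∑ i, ∫ v, D i v * (l i - Γ.c v) ∂Γ.μ ≤ ∑ i, k i := by
          refine Finset.sum_le_sum fun i _ => ?_
          rw [← hGk' i (hl i)]
          refine integral_mono (hDint i ((integrable_const _).sub integrable_c))
            (hDint i (hGint _)) fun v => ?_
          by_cases hv : D i v = 0
          · simp [hv]
          · have := hGl i v hv
            have h0 := hD0 i v
            change D i v * (l i - Γ.c v) ≤ D i v * G (l i) v
            gcongr
            linarith
      _ = finProfit S (Γ.cellCost δ) w p₀ := hk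
      _ ≤ ∫ v : Γ.V, ({v : Γ.V | p₀ ≤ (v : ℝ)}.indicator (fun v => p₀ - Γ.c v) v + 2 * δ) ∂Γ.μ := by
          rw [finProfit_eq_integral hS]
          have e : ∫ v : Γ.V, w (gridFloor δ v) / w (gridFloor δ v) * G p₀ v ∂Γ.μ =
              ∫ v, G p₀ v ∂Γ.μ := by
            refine integral_congr_ae ?_
            filter_upwards [ae_cellMass_pos Γ δ] with v hv
            rw [div_self hv.ne', one_mul]
          refine e.trans_le (integral_mono (hGint _)
            (hind.add (integrable_const _)) fun v => ?_)
          obtain ⟨v₀, hv₀⟩ := hSv p₀ hp₀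
          -- a price on the grid is below `v` if and only if it is below the grid point of `v`
          have hiff : p₀ ≤ gridFloor δ v ↔ p₀ ≤ (v : ℝ) := by
            refine ⟨fun h => h.trans (gridFloor_le hδ _), fun h => ?_⟩
            rw [← hv₀, ← gridFloor_gridFloor hδ, hv₀]
            exact gridFloor_mono hδ h
          simp only [hG, hiff, Set.indicator_apply, Set.mem_ofPred_eq]
          split_ifs <;> linarith
      _ = Γ.profit Γ.μ p₀ + 2 * δ := by
          rw [integral_add hind (integrable_const _), integral_indicator (measurableSet_le_coe p₀)]
          simp [profit]
      _ ≤ Γ.sellerGuaranteeFB + 2 * δ := by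
          gcongr
          exact Γ.profit_le_sellerGuaranteeFB p₀

end Environment

/-! ### Weak limits and mixtures of segmentations -/

namespace Environment

variable {Γ : Environment}

open Filter Topology in
/-- Some segmentation is exactly optimal for Seller and gives her no more than the profit of an
uninformed Seller: a weak limit of approximate segmentations. -/
lemma exists_isSegmentation {M : ℝ} (hM : ∀ v : Γ.V, |(v : ℝ)| ≤ M) :
    ∃ η : Measure (PricePair (M + 1) × Γ.V), Γ.IsSegmentation (M + 1) 0 η ∧
      ∫ x, ((x.1.1 : ℝ) - Γ.c x.2) ∂η ≤ Γ.sellerGuaranteeFB := by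
  have hc := Γ.continuous_c
  set δ : ℕ → ℝ := fun n => 1 / ((n : ℝ) + 1)
  have hδ (n) : 0 < δ n := Nat.one_div_pos_of_nat
  have hδ1 (n) : δ n ≤ 1 := by
    have : (0 : ℝ) ≤ n := n.cast_nonneg
    exact (div_le_one (by linarith)).2 (by linarith)
  choose η hη hprofit using fun n => exists_isSegmentation_approx hM (hδ n) (hδ1 n)
  set P : ℕ → ProbabilityMeasure (PricePair (M + 1) × Γ.V) :=
    fun n => ⟨η n, (hη n).isProbabilityMeasure⟩
  set η₀ := ((hyperfilter ℕ).map P).lim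
  have hlim : Tendsto P (hyperfilter ℕ) (𝓝 η₀) := ((hyperfilter ℕ).map P).le_nhds_lim
  have hδ0 : Tendsto δ (hyperfilter ℕ) (𝓝 0) :=
    tendsto_one_div_add_atTop_nhds_zero_nat.mono_left (Nat.hyperfilter_le_atTop)
  have hint {f : PricePair (M + 1) × Γ.V → ℝ} (hf : Continuous f) :
      Tendsto (fun n => ∫ x, f x ∂(η n)) (hyperfilter ℕ)
        (𝓝 (∫ x, f x ∂(η₀ : Measure (PricePair (M + 1) × Γ.V)))) :=
    (ProbabilityMeasure.tendsto_iff_forall_integral_tendsto.1 hlim)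
      (BoundedContinuousFunction.mkOfCompact ⟨f, hf⟩)
  refine ⟨η₀, ⟨?_, ?_, ?_, ?_⟩, ?_⟩
  · have : IsProbabilityMeasure
        ((η₀ : Measure (PricePair (M + 1) × Γ.V)).map Prod.snd) :=
      Measure.isProbabilityMeasure_map measurable_snd.aemeasurable
    refine ext_of_forall_integral_eq_of_IsFiniteMeasure fun f => ?_
    rw [integral_map measurable_snd.aemeasurable f.continuous.aestronglyMeasurable]
    refine tendsto_nhds_unique (hint (f := fun x => f x.2) (by fun_prop)) ?_
    refine tendsto_const_nhds.congr fun n => ?_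
    rw [← (hη n).map_snd,
      integral_map measurable_snd.aemeasurable f.continuous.aestronglyMeasurable]
  · set g : PricePair (M + 1) × Γ.V → ℝ :=
      fun x => max 0 ((x.1.1 : ℝ) - x.2) + max 0 ((x.2 : ℝ) - x.1.2) with hg
    have hgc : Continuous g := by fun_prop
    have h0 : ∫ x, g x ∂(η₀ : Measure (PricePair (M + 1) × Γ.V)) = 0 := by
      refine tendsto_nhds_unique (hint hgc) (tendsto_const_nhds.congr fun n => ?_)
      refine (integral_eq_zero_of_ae ?_).symm
      filter_upwards [(hη n).between] with x hx
      simp [hg, hx.1, hx.2]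
    rw [integral_eq_zero_iff_of_nonneg (fun x => by positivity)
      hgc.integrable_of_compactSpace] at h0
    filter_upwards [h0] with x hx
    have h1 := le_max_left 0 ((x.1.1 : ℝ) - x.2)
    have h2 := le_max_left 0 ((x.2 : ℝ) - x.1.2)
    have h3 := le_max_right 0 ((x.1.1 : ℝ) - x.2)
    have h4 := le_max_right 0 ((x.2 : ℝ) - x.1.2)
    have h5 : max 0 ((x.1.1 : ℝ) - x.2) + max 0 ((x.2 : ℝ) - x.1.2) = 0 := hx
    constructor <;> linarith
  · intro H hH q p hqp
    exact le_of_tendsto_of_tendsto (hint (by fun_prop))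
      ((hδ0.const_mul 2).mul (hint (f := fun x => H x.1) (by fun_prop)))
      (.of_forall fun n => (hη n).low H hH q p hqp)
  · intro H hH κ hκ _ q p hqp
    refine le_of_tendsto_of_tendsto (hint (by fun_prop))
      ((hδ0.const_mul 2).mul (hint (f := fun x => H x.1) (by fun_prop))) ?_
    filter_upwards [hδ0.eventually (gt_mem_nhds hκ)] with n hn
    exact (hη n).high H hH κ hκ hn.le q p hqp
  · refine le_of_tendsto_of_tendsto (hint (by fun_prop))
      (by simpa using (hδ0.const_mul 2).const_add Γ.sellerGuaranteeFB)
      (.of_forall fun n => hprofit n)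

/-- The segmentation that reveals the value, with `l = h = v`. -/
def fullRevelation (Γ : Environment) {R : ℝ} (hR : ∀ v : Γ.V, (v : ℝ) ∈ Set.Icc (-R) R) :
    Measure (PricePair R × Γ.V) :=
  Γ.μ.map fun v : Γ.V => ((⟨v, hR v⟩, ⟨v, hR v⟩), v)

section fullRevelation

variable {R : ℝ} (hR : ∀ v : Γ.V, (v : ℝ) ∈ Set.Icc (-R) R)

lemma measurable_fullRevelation :
    Measurable fun v : Γ.V => (((⟨v, hR v⟩, ⟨v, hR v⟩), v) : PricePair R × Γ.V) := by
  fun_prop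

lemma integral_fullRevelation {f : PricePair R × Γ.V → ℝ} (hf : Continuous f) :
    ∫ x, f x ∂Γ.fullRevelation hR = ∫ v : Γ.V, f ((⟨v, hR v⟩, ⟨v, hR v⟩), v) ∂Γ.μ :=
  integral_map (measurable_fullRevelation hR).aemeasurable hf.aestronglyMeasurable

lemma isSegmentation_fullRevelation : Γ.IsSegmentation R 0 (Γ.fullRevelation hR) where
  map_snd := by
    rw [fullRevelation, Measure.map_map measurable_snd (measurable_fullRevelation hR)]
    exact Measure.map_id
  between := by
    rw [fullRevelation, ae_map_iff (measurable_fullRevelation hR).aemeasurable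
      measurableSet_between]
    exact .of_forall fun v => ⟨le_rfl, le_rfl⟩
  low H hH q p hqp := by
    rw [integral_fullRevelation hR (by fun_prop), mul_zero, zero_mul]
    refine integral_nonpos fun v => mul_nonpos_of_nonneg_of_nonpos (hH _) ?_
    have h1 := smoothGain_le hqp v
    have h2 := Γ.c_le v
    simp only [lowGain]
    split_ifs at h1 <;> linarith
  high H hH κ hκ _ q p hqp := by
    rw [integral_fullRevelation hR (by fun_prop), mul_zero, zero_mul]
    refine integral_nonpos fun v => mul_nonpos_of_nonneg_of_nonpos (hH _) ?_
    have h1 := smoothGain_le hqp v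
    have h2 := Γ.c_le v
    simp only [highGain, smoothTopGain]
    rw [ramp_of_le (by linarith) (by linarith)]
    split_ifs at h1 <;> linarith

end fullRevelation

/-- The mixture of two measures with weights `θ` and `1 - θ`. -/
def convexMix {X : Type*} [MeasurableSpace X] (θ : ℝ) (η η' : Measure X) : Measure X :=
  ENNReal.ofReal θ • η + ENNReal.ofReal (1 - θ) • η'

section convexMix

variable {X : Type*} [MeasurableSpace X] {θ : ℝ} {η η' : Measure X}

lemma integral_convexMix (hθ : θ ∈ Set.Icc (0 : ℝ) 1) {f : X → ℝ} (hf : Integrable f η)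
    (hf' : Integrable f η') :
    ∫ x, f x ∂convexMix θ η η' = θ * ∫ x, f x ∂η + (1 - θ) * ∫ x, f x ∂η' := by
  rw [convexMix, integral_add_measure (hf.smul_measure ENNReal.ofReal_ne_top)
    (hf'.smul_measure ENNReal.ofReal_ne_top), integral_smul_measure, integral_smul_measure,
    ENNReal.toReal_ofReal hθ.1, ENNReal.toReal_ofReal (sub_nonneg.2 hθ.2), smul_eq_mul,
    smul_eq_mul]

lemma ae_convexMix {p : X → Prop} (h : ∀ᵐ x ∂η, p x) (h' : ∀ᵐ x ∂η', p x) :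
    ∀ᵐ x ∂convexMix θ η η', p x :=
  ae_add_measure_iff.2 ⟨Measure.ae_smul_measure h _, Measure.ae_smul_measure h' _⟩

lemma map_convexMix {Y : Type*} [MeasurableSpace Y] {f : X → Y} (hf : Measurable f) :
    (convexMix θ η η').map f = convexMix θ (η.map f) (η'.map f) := by
  rw [convexMix, Measure.map_add _ _ hf, Measure.map_smul, Measure.map_smul, convexMix]

lemma convexMix_self (hθ : θ ∈ Set.Icc (0 : ℝ) 1) : convexMix θ η η = η := by
  rw [convexMix, ← add_smul, ← ENNReal.ofReal_add hθ.1 (sub_nonneg.2 hθ.2)]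
  simp

end convexMix

lemma IsSegmentation.mix {R θ : ℝ} {η η' : Measure (PricePair R × Γ.V)}
    (hη : Γ.IsSegmentation R 0 η) (hη' : Γ.IsSegmentation R 0 η') (hθ : θ ∈ Set.Icc (0 : ℝ) 1) :
    Γ.IsSegmentation R 0 (convexMix θ η η') := by
  have := hη.isProbabilityMeasure
  have := hη'.isProbabilityMeasure
  have h1 : 0 ≤ 1 - θ := sub_nonneg.2 hθ.2
  refine ⟨?_, ae_convexMix hη.between hη'.between, fun H hH q p hqp => ?_,
    fun H hH κ hκ hκ' q p hqp => ?_⟩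
  · rw [map_convexMix measurable_snd, hη.map_snd, hη'.map_snd, convexMix_self hθ]
  · have e1 := hη.low H hH q p hqp
    have e2 := hη'.low H hH q p hqp
    rw [mul_zero, zero_mul] at *
    rw [integral_convexMix hθ (Continuous.integrable_of_compactSpace (by fun_prop))
      (Continuous.integrable_of_compactSpace (by fun_prop))]
    nlinarith [mul_nonneg hθ.1 (neg_nonneg.2 e1), mul_nonneg h1 (neg_nonneg.2 e2)]
  · have e1 := hη.high H hH κ hκ hκ' q p hqp
    have e2 := hη'.high H hH κ hκ hκ' q p hqp
    rw [mul_zero, zero_mul] at *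
    rw [integral_convexMix hθ (Continuous.integrable_of_compactSpace (by fun_prop))
      (Continuous.integrable_of_compactSpace (by fun_prop))]
    nlinarith [mul_nonneg hθ.1 (neg_nonneg.2 e1), mul_nonneg h1 (neg_nonneg.2 e2)]

end Environment

/-! ### Optimality of both prices conditional on the signal -/

/-- A bounded function is almost everywhere nonpositive when its integral against every nonnegative
continuous weight is. -/
lemma ae_nonpos_of_forall_integral_mul_nonpos {T : Type*} [TopologicalSpace T] [NormalSpace T]
    [MeasurableSpace T] [BorelSpace T] {ρ : Measure T} [IsFiniteMeasure ρ] [ρ.WeaklyRegular]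
    {g : T → ℝ} (hg : Measurable g) {B : ℝ} (hB : ∀ t, |g t| ≤ B)
    (h : ∀ H : C(T, ℝ), (∀ t, 0 ≤ H t) → ∫ t, H t * g t ∂ρ ≤ 0) :
    ∀ᵐ t ∂ρ, g t ≤ 0 := by
  rcases isEmpty_or_nonempty T with hT | ⟨⟨t₀⟩⟩
  · exact .of_forall fun t => hT.elim t
  have hB0 : 0 ≤ B := (abs_nonneg _).trans (hB t₀)
  have hA : MeasurableSet {t | 0 < g t} := hg measurableSet_Ioi
  have hgi : Integrable g ρ := .of_bound hg.aestronglyMeasurable B (.of_forall hB)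
  have hle : ∫ t in {t | 0 < g t}, g t ∂ρ ≤ 0 := by
    refine le_of_forall_pos_le_add fun ε hε => ?_
    obtain ⟨H, hH, hHi⟩ := ((integrable_const (μ := ρ) (1 : ℝ)).indicator
      hA).exists_boundedContinuous_integral_sub_le (ε := ε / (B + 1)) (by positivity)
    set K : C(T, ℝ) := ⟨fun t => max 0 (H t), by fun_prop⟩
    have hKi : Integrable (fun t => K t * g t) ρ :=
      ((integrable_zero _ _ _).sup hHi).mul_bdd (c := B) hg.aestronglyMeasurable (.of_forall hB)
    have hpt (t) : {t | 0 < g t}.indicator g t - K t * g t ≤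
        B * ‖{t | 0 < g t}.indicator (fun _ => (1 : ℝ)) t - H t‖ := by
      have h1 : |{t | 0 < g t}.indicator (fun _ => (1 : ℝ)) t - max 0 (H t)| ≤
          |{t | 0 < g t}.indicator (fun _ => (1 : ℝ)) t - H t| := by
        have : 0 ≤ {t | 0 < g t}.indicator (fun _ => (1 : ℝ)) t :=
          Set.indicator_nonneg (fun _ _ => zero_le_one) t
        rcases le_total 0 (H t) with h0 | h0
        · rw [max_eq_right h0]
        · rw [max_eq_left h0, sub_zero, abs_of_nonneg this, abs_of_nonneg (by linarith)]
          linarith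
      have h2 : {t | 0 < g t}.indicator g t =
          {t | 0 < g t}.indicator (fun _ => (1 : ℝ)) t * g t := by
        simp [Set.indicator_apply]
      calc _ = ({t | 0 < g t}.indicator (fun _ => (1 : ℝ)) t - max 0 (H t)) * g t := by
            rw [h2, sub_mul]
            rfl
        _ ≤ |({t | 0 < g t}.indicator (fun _ => (1 : ℝ)) t - max 0 (H t)) * g t| := le_abs_self _
        _ ≤ |{t | 0 < g t}.indicator (fun _ => (1 : ℝ)) t - H t| * B := by
            rw [abs_mul]
            exact mul_le_mul h1 (hB t) (abs_nonneg _) (abs_nonneg _)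
        _ = _ := by rw [mul_comm, Real.norm_eq_abs]
    have h3 : ∫ t, ({t | 0 < g t}.indicator g t - K t * g t) ∂ρ ≤ B * (ε / (B + 1)) := by
      refine (integral_mono ((hgi.indicator hA).sub hKi) ?_ hpt).trans ?_
      · exact ((((integrable_const (μ := ρ) (1 : ℝ)).indicator hA).sub hHi).norm).const_mul B
      · rw [integral_const_mul]
        gcongr
    rw [integral_sub (hgi.indicator hA) hKi, integral_indicator hA] at h3
    have h4 := h K fun t => le_max_left _ _
    have h5 : B * (ε / (B + 1)) ≤ ε := by
      rw [mul_div_assoc', div_le_iff₀ (by positivity)]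
      nlinarith
    linarith
  have h0 : ∫ t in {t | 0 < g t}, g t ∂ρ = 0 :=
    le_antisymm hle (setIntegral_nonneg hA fun t ht => le_of_lt ht)
  rw [setIntegral_eq_zero_iff_of_nonneg_ae (ae_restrict_of_forall_mem hA fun t ht => le_of_lt ht)
    hgi.integrableOn, Filter.EventuallyEq, ae_restrict_iff' hA] at h0
  filter_upwards [h0] with t ht
  by_contra hc
  exact hc (ht (not_le.1 hc)).le

namespace Environment

variable {Γ : Environment}

/-- Seller's utility from the price `p` when the value is `v` and Buyer accepts if `p ≤ v`. -/
def gain (Γ : Environment) (p : ℝ) (v : Γ.V) : ℝ := if p ≤ (v : ℝ) then p - Γ.c v else 0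

lemma measurable_gain : Measurable fun x : ℝ × Γ.V => Γ.gain x.1 x.2 := by
  have := Γ.measurable_c
  exact Measurable.ite (measurableSet_le (by fun_prop) (by fun_prop)) (by fun_prop) (by fun_prop)

lemma profit_eq_integral_gain (m : Measure Γ.V) (p : ℝ) : Γ.profit m p = ∫ v, Γ.gain p v ∂m := by
  rw [profit, ← integral_indicator (measurableSet_le_coe p)]
  rfl

lemma integrable_gain {m : Measure Γ.V} [IsFiniteMeasure m] (p : ℝ) :
    Integrable (Γ.gain p) m := by
  obtain ⟨M, hM⟩ := Γ.exists_bound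
  refine .of_bound (C := |p| + M) (measurable_gain.comp measurable_prodMk_left).aestronglyMeasurable
    (.of_forall fun v => ?_)
  have hM0 : 0 ≤ M := (abs_nonneg _).trans (hM v).1
  unfold gain
  split_ifs
  · exact (abs_sub _ _).trans (by linarith [(hM v).2])
  · simpa using add_nonneg (abs_nonneg p) hM0

section Conditional

variable {R : ℝ} {η : Measure (PricePair R × Γ.V)} [IsProbabilityMeasure η]

/-- Conditional form of an inequality tested against continuous weights. -/
lemma ae_integral_condKernel_nonpos {f : PricePair R × Γ.V → ℝ}
    (hf : Continuous f)
    (h : ∀ H : C(PricePair R, ℝ), (∀ t, 0 ≤ H t) → ∫ x, H x.1 * f x ∂η ≤ 0) :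
    ∀ᵐ t ∂η.fst, ∫ v, f (t, v) ∂η.condKernel t ≤ 0 := by
  obtain ⟨B, hB⟩ := (isCompact_range hf).isBounded.exists_norm_le
  refine ae_nonpos_of_forall_integral_mul_nonpos (B := B)
    (StronglyMeasurable.integral_kernel_prod_right' hf.stronglyMeasurable).measurable
    (fun t => ?_) fun H hH => ?_
  · refine (norm_integral_le_of_norm_le_const (C := B) (.of_forall fun v => hB _ ⟨_, rfl⟩)).trans ?_
    simp
  · refine le_trans (le_of_eq ?_) (h H hH)
    rw [← Measure.integral_condKernel (ρ := η) (f := fun x => H x.1 * f x)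
      (Continuous.integrable_of_compactSpace (by fun_prop))]
    simp_rw [integral_const_mul]

lemma IsSegmentation.ae_between (hη : Γ.IsSegmentation R 0 η) :
    ∀ᵐ t ∂η.fst, ∀ᵐ v : Γ.V ∂η.condKernel t, (t.1 : ℝ) ≤ v ∧ (v : ℝ) ≤ t.2 := by
  have := hη.between
  rw [← η.disintegrate η.condKernel] at this
  exact Measure.ae_ae_of_ae_compProd this

lemma IsSegmentation.ae_profit_low (hη : Γ.IsSegmentation R 0 η) :
    ∀ᵐ t ∂η.fst, Γ.profit (η.condKernel t) t.1 = t.1 - ∫ v, Γ.c v ∂η.condKernel t := by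
  filter_upwards [hη.ae_between] with t ht
  rw [profit_eq_integral_gain, integral_congr_ae (g := fun v => (t.1 : ℝ) - Γ.c v),
    integral_sub (integrable_const _) Γ.continuous_c.integrable_of_compactSpace]
  · simp
  · filter_upwards [ht] with v hv
    exact if_pos hv.1

/-- If all smoothed gains from rational prices are at most `L`, then so is the profit from every
price. -/
lemma profit_le_of_smoothGain_le {m : Measure Γ.V} [IsProbabilityMeasure m] {L : ℝ}
    (h : ∀ q p : ℚ, (q : ℝ) < p → ∫ v, Γ.smoothGain q p v ∂m - (p - q) ≤ L) (p : ℝ) :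
    Γ.profit m p ≤ L := by
  refine le_of_forall_pos_le_add fun ε hε => ?_
  obtain ⟨q, hq1, hq2⟩ := exists_rat_btwn (show p - ε / 2 < p by linarith)
  obtain ⟨p', hp1, hp2⟩ := exists_rat_btwn hq2
  have h1 := h q p' hp1
  have hi : Integrable (Γ.smoothGain q p') m :=
    (continuous_smoothGain _ _).integrable_of_compactSpace
  have h2 : Γ.profit m p ≤ ∫ v, (Γ.smoothGain q p' v + (p - q)) ∂m := by
    rw [profit_eq_integral_gain]
    exact integral_mono (integrable_gain p) (hi.add (integrable_const _))
      fun v => le_smoothGain hp1 hp2.le v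
  rw [integral_add hi (integrable_const _)] at h2
  simp only [integral_const, probReal_univ, smul_eq_mul, one_mul] at h2
  linarith

/-- Almost surely, no price is better for Seller than the lower price of her signal. -/
lemma IsSegmentation.ae_profit_le_low (hη : Γ.IsSegmentation R 0 η) :
    ∀ᵐ t ∂η.fst, ∀ p, Γ.profit (η.condKernel t) p ≤ Γ.profit (η.condKernel t) t.1 := by
  have h : ∀ q p : ℚ, ∀ᵐ t ∂η.fst, (q : ℝ) < p →
      ∫ v, Γ.lowGain q p (t, v) ∂η.condKernel t ≤ 0 := fun q p => by
    by_cases hqp : (q : ℝ) < p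
    · filter_upwards [ae_integral_condKernel_nonpos (continuous_lowGain q p)
        fun H hH => by simpa using hη.low H hH q p hqp] with t ht _ using ht
    · simp [hqp]
  filter_upwards [hη.ae_profit_low, ae_all_iff.2 fun q => ae_all_iff.2 (h q)] with t ht0 ht
  refine profit_le_of_smoothGain_le fun q p hqp => ?_
  have h1 := ht q p hqp
  have hi : Integrable (Γ.smoothGain q p) (η.condKernel t) :=
    (continuous_smoothGain _ _).integrable_of_compactSpace
  have hci : Integrable Γ.c (η.condKernel t) := Γ.continuous_c.integrable_of_compactSpace
  have hi' : Integrable (fun v => Γ.smoothGain q p v - ((p : ℝ) - q)) (η.condKernel t) :=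
    hi.sub (integrable_const _)
  have hci' : Integrable (fun v => (t.1 : ℝ) - Γ.c v) (η.condKernel t) :=
    (integrable_const _).sub hci
  simp only [lowGain] at h1
  rw [integral_sub hi' hci', integral_sub hi (integrable_const _),
    integral_sub (integrable_const _) hci] at h1
  simp only [integral_const, probReal_univ, smul_eq_mul, one_mul] at h1
  rw [ht0]
  linarith

open Filter Topology in
/-- Almost surely, no price is better for Seller than the higher price of her signal. -/
lemma IsSegmentation.ae_profit_le_high (hη : Γ.IsSegmentation R 0 η) :
    ∀ᵐ t ∂η.fst, ∀ p, Γ.profit (η.condKernel t) p ≤ Γ.profit (η.condKernel t) t.2 := by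
  set κ : ℕ → ℝ := fun n => 1 / ((n : ℝ) + 1)
  have hκ (n) : 0 < κ n := Nat.one_div_pos_of_nat
  have h : ∀ (q p : ℚ) (n : ℕ), ∀ᵐ t ∂η.fst, (q : ℝ) < p →
      ∫ v, Γ.highGain (κ n) q p (t, v) ∂η.condKernel t ≤ 0 := fun q p n => by
    by_cases hqp : (q : ℝ) < p
    · filter_upwards [ae_integral_condKernel_nonpos (continuous_highGain (κ n) q p)
        fun H hH => by simpa using hη.high H hH (κ n) (hκ n) (hκ n).le q p hqp] with t ht _ using ht
    · simp [hqp]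
  filter_upwards [hη.ae_between,
    ae_all_iff.2 fun q => ae_all_iff.2 fun p => ae_all_iff.2 (h q p)] with t htb ht
  have htop (n) : Integrable (fun v => Γ.smoothTopGain (κ n) t.2 v) (η.condKernel t) := by
    have := Γ.continuous_c
    unfold smoothTopGain
    exact Continuous.integrable_of_compactSpace (by fun_prop)
  refine profit_le_of_smoothGain_le fun q p hqp => ?_
  -- values below the top price `h` stop buying in the limit
  have hlim : Tendsto (fun n => ∫ v, Γ.smoothTopGain (κ n) t.2 v ∂η.condKernel t) atTop
      (𝓝 (Γ.profit (η.condKernel t) t.2)) := by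
    obtain ⟨M, hM⟩ := Γ.exists_bound
    rw [profit_eq_integral_gain]
    refine tendsto_integral_of_dominated_convergence (fun _ => |(t.2 : ℝ)| + M)
      (fun n => (htop n).aestronglyMeasurable) (integrable_const _)
      (fun n => .of_forall fun v => ?_) ?_
    · have h0 := ramp_nonneg (q := κ n) (p := 2 * κ n) (v := t.2 - v)
      have h1 := ramp_le_one (q := κ n) (p := 2 * κ n) (v := t.2 - v)
      rw [smoothTopGain, norm_mul, Real.norm_eq_abs, Real.norm_eq_abs,
        abs_of_nonneg (sub_nonneg.2 h1)]
      calc _ ≤ 1 * |(t.2 : ℝ) - Γ.c v| := by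
            gcongr
            linarith
        _ ≤ |(t.2 : ℝ)| + M := by
            rw [one_mul]
            exact (abs_sub _ _).trans (by linarith [(hM v).2])
    · filter_upwards [htb] with v hv
      rcases hv.2.eq_or_lt with heq | hlt
      · refine tendsto_const_nhds.congr fun n => ?_
        rw [gain, if_pos heq.ge, smoothTopGain, ramp_of_le (by linarith [hκ n])
          (by linarith [hκ n])]
        ring
      · have hev : ∀ᶠ n in atTop, 2 * κ n < t.2 - v := by
          have : Tendsto (fun n => 2 * κ n) atTop (𝓝 (2 * 0)) :=
            tendsto_one_div_add_atTop_nhds_zero_nat.const_mul 2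
          rw [mul_zero] at this
          exact this.eventually (gt_mem_nhds (sub_pos.2 hlt))
        refine tendsto_const_nhds.congr' ?_
        filter_upwards [hev] with n hn
        rw [gain, if_neg (not_le.2 hlt), smoothTopGain,
          ramp_of_ge (by linarith [hκ n]) hn.le]
        ring
  refine ge_of_tendsto' hlim fun n => ?_
  have h1 := ht q p n hqp
  have hi : Integrable (Γ.smoothGain q p) (η.condKernel t) :=
    (continuous_smoothGain _ _).integrable_of_compactSpace
  have hi' : Integrable (fun v => Γ.smoothGain q p v - ((p : ℝ) - q)) (η.condKernel t) :=
    hi.sub (integrable_const _)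
  simp only [highGain] at h1
  rw [integral_sub hi' (htop n), integral_sub hi (integrable_const _)] at h1
  simp only [integral_const, probReal_univ, smul_eq_mul, one_mul] at h1
  linarith

end Conditional

end Environment

/-! ### The equilibrium that a segmentation induces -/

lemma map_prodMk_compProd_condKernel {T Ω : Type*} [MeasurableSpace T] [MeasurableSpace Ω]
    [StandardBorelSpace Ω] [Nonempty Ω] {η : Measure (T × Ω)} [IsFiniteMeasure η] {g : T → ℝ}
    (hg : Measurable g) :
    (η.fst.map fun t => (t, g t)) ⊗ₘ η.condKernel.comap Prod.fst measurable_fst =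
      η.map fun x => ((x.1, g x.1), x.2) := by
  refine Measure.ext_of_lintegral _ fun f hf => ?_
  have hm : Measurable fun y : T × ℝ => ∫⁻ v, f (y, v) ∂η.condKernel y.1 :=
    hf.lintegral_kernel_prod_right' (κ := η.condKernel.comap Prod.fst measurable_fst)
  rw [Measure.lintegral_compProd hf, lintegral_map hf (by fun_prop)]
  simp only [Kernel.comap_apply]
  rw [lintegral_map hm (by fun_prop)]
  conv_rhs => rw [← η.disintegrate η.condKernel]
  rw [Measure.lintegral_compProd (by fun_prop)]

namespace InfoStructure

variable {Γ : Environment} {Ts Tb : Type} [MeasurableSpace Ts] [MeasurableSpace Tb]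
  (τ : InfoStructure Γ Ts Tb) (σ : τ.SellerStrategy)

instance : IsMarkovKernel σ.priceKernel :=
  inferInstanceAs (IsMarkovKernel σ.law.condKernel)

instance : IsProbabilityMeasure (τ.outcome σ) :=
  inferInstanceAs (IsProbabilityMeasure (τ.P ⊗ₘ σ.priceKernel.comap Prod.fst measurable_fst))

lemma fst_outcome : (τ.outcome σ).fst = τ.P := Measure.fst_compProd _ _

lemma ae_outcome_of_ae {p : Ts × Tb × Γ.V → Prop} (h : ∀ᵐ x ∂τ.P, p x) :
    ∀ᵐ x ∂τ.outcome σ, p x.1 := by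
  rw [← τ.fst_outcome σ] at h
  exact ae_of_ae_map measurable_fst.aemeasurable h

/-- The value and the price are independent conditional on Seller's signal. -/
lemma map_outcome_eq_compProd (η : Measure (Ts × Γ.V)) [IsProbabilityMeasure η]
    (hη : τ.P.map (fun x => (x.1, x.2.2)) = η) :
    (τ.outcome σ).map (fun x => ((x.1.1, x.2), x.1.2.2)) =
      σ.law ⊗ₘ η.condKernel.comap Prod.fst measurable_fst := by
  have hfst : η.fst = σ.law.fst := by
    rw [σ.fst_law, ← hη, Measure.fst, Measure.map_map measurable_fst (by fun_prop)]
    rfl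
  refine Measure.ext_of_lintegral _ fun f hf => ?_
  rw [lintegral_map hf (by fun_prop), outcome, Measure.lintegral_compProd (by fun_prop),
    Measure.lintegral_compProd hf]
  simp only [Kernel.comap_apply]
  have hm : Measurable fun y : Ts × Γ.V => ∫⁻ p, f ((y.1, p), y.2) ∂σ.priceKernel y.1 := by
    have : Measurable fun z : (Ts × Γ.V) × ℝ => f ((z.1.1, z.2), z.1.2) := by fun_prop
    exact this.lintegral_kernel_prod_right' (κ := σ.priceKernel.comap Prod.fst measurable_fst)
  have hm' : Measurable fun y : Ts × ℝ => ∫⁻ v, f (y, v) ∂η.condKernel y.1 :=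
    hf.lintegral_kernel_prod_right' (κ := η.condKernel.comap Prod.fst measurable_fst)
  calc ∫⁻ x, ∫⁻ p, f ((x.1, p), x.2.2) ∂σ.priceKernel x.1 ∂τ.P
      = ∫⁻ y, ∫⁻ p, f ((y.1, p), y.2) ∂σ.priceKernel y.1 ∂η := by
        rw [← hη, lintegral_map hm (by fun_prop)]
    _ = ∫⁻ t, ∫⁻ v, ∫⁻ p, f ((t, p), v) ∂σ.priceKernel t ∂η.condKernel t ∂η.fst := by
        conv_lhs => rw [← η.disintegrate η.condKernel]
        rw [Measure.lintegral_compProd hm]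
    _ = ∫⁻ t, ∫⁻ p, ∫⁻ v, f ((t, p), v) ∂η.condKernel t ∂σ.priceKernel t ∂η.fst := by
        refine lintegral_congr fun t => lintegral_lintegral_swap ?_
        exact Measurable.aemeasurable (by fun_prop)
    _ = ∫⁻ y, ∫⁻ v, f (y, v) ∂η.condKernel y.1 ∂σ.law := by
        conv_rhs => rw [← σ.law.disintegrate σ.law.condKernel]
        rw [Measure.lintegral_compProd hm', hfst]
        rfl

end InfoStructure

namespace Environment

open InfoStructure

variable {Γ : Environment}

/-- A fully informed Buyer who accepts every price up to his value. -/
def thresholdBuyer (Γ : Environment) : BuyerStrategy Γ.V where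
  prob x := if x.1 ≤ (x.2 : ℝ) then 1 else 0
  measurable_prob := Measurable.ite (measurableSet_le (by fun_prop) (by fun_prop))
    measurable_const measurable_const
  prob_mem x := by split_ifs <;> simp

/-- The beliefs of a Buyer whose signal is the value. -/
def truthfulBelief (Γ : Environment) : Kernel (ℝ × Γ.V) Γ.V :=
  Kernel.deterministic Prod.snd measurable_snd

variable {R : ℝ} {η : Measure (PricePair R × Γ.V)}

/-- The information structure in which Seller observes the price pair of a segmentation and Buyer
observes the value. -/
def IsSegmentation.info (hη : Γ.IsSegmentation R 0 η) : InfoStructure Γ (PricePair R) Γ.V where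
  P := η.map fun x => (x.1, x.2, x.2)
  isProbabilityMeasure_P := by
    have := hη.isProbabilityMeasure
    exact Measure.isProbabilityMeasure_map (by fun_prop)
  map_value := by
    rw [Measure.map_map (by fun_prop) (by fun_prop), ← hη.map_snd]
    rfl

namespace IsSegmentation

variable (hη : Γ.IsSegmentation R 0 η)

lemma fullyInformedBuyer_info : hη.info.FullyInformedBuyer := by
  have hm : MeasurableSet {x : PricePair R × Γ.V × Γ.V | x.2.1 = x.2.2} :=
    measurableSet_eq_fun (by fun_prop) (by fun_prop)
  refine (ae_map_iff (Measurable.aemeasurable (by fun_prop)) hm).2 (.of_forall fun x => rfl)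

lemma map_info : hη.info.P.map (fun x => (x.1, x.2.2)) = η := by
  rw [info, Measure.map_map (by fun_prop) (by fun_prop)]
  exact Measure.map_id

lemma map_fst_info : hη.info.P.map (fun x => x.1) = η.fst := by
  rw [info, Measure.map_map (by fun_prop) (by fun_prop)]
  rfl

/-- Seller posts the lower price of her signal with probability `θ`, otherwise the higher one. -/
def strategy (θ : ℝ) (hθ : θ ∈ Set.Icc (0 : ℝ) 1) : hη.info.SellerStrategy where
  law := convexMix θ (η.fst.map fun t => (t, (t.1 : ℝ))) (η.fst.map fun t => (t, (t.2 : ℝ)))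
  isProbabilityMeasure_law := by
    have := hη.isProbabilityMeasure
    have h : ((convexMix θ (η.fst.map fun t => (t, (t.1 : ℝ)))
        (η.fst.map fun t => (t, (t.2 : ℝ)))).map Prod.fst) = η.fst := by
      rw [map_convexMix measurable_fst, Measure.map_map measurable_fst (by fun_prop),
        Measure.map_map measurable_fst (by fun_prop)]
      exact (convexMix_self hθ).trans Measure.map_id
    have : IsProbabilityMeasure ((convexMix θ (η.fst.map fun t => (t, (t.1 : ℝ)))
        (η.fst.map fun t => (t, (t.2 : ℝ)))).map Prod.fst) := by
      rw [h]
      infer_instance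
    exact Measure.isProbabilityMeasure_of_map Prod.fst
  fst_law := by
    rw [map_fst_info, Measure.fst, map_convexMix measurable_fst,
      Measure.map_map measurable_fst (by fun_prop), Measure.map_map measurable_fst (by fun_prop)]
    exact (convexMix_self hθ).trans Measure.map_id

/-- The law of the signal, the price and the value when Seller mixes between her two prices. -/
lemma map_outcome_strategy (θ : ℝ) (hθ : θ ∈ Set.Icc (0 : ℝ) 1) :
    (hη.info.outcome (hη.strategy θ hθ)).map (fun x => ((x.1.1, x.2), x.1.2.2)) =
      convexMix θ (η.map fun x => ((x.1, (x.1.1 : ℝ)), x.2))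
        (η.map fun x => ((x.1, (x.1.2 : ℝ)), x.2)) := by
  have := hη.isProbabilityMeasure
  rw [map_outcome_eq_compProd _ _ η hη.map_info]
  have h₁ := map_prodMk_compProd_condKernel (η := η) (g := fun t => (t.1 : ℝ)) (by fun_prop)
  have h₂ := map_prodMk_compProd_condKernel (η := η) (g := fun t => (t.2 : ℝ)) (by fun_prop)
  rw [← h₁, ← h₂]
  simp only [convexMix, strategy]
  rw [Measure.compProd_add_left, Measure.compProd_smul_left, Measure.compProd_smul_left]

lemma ae_eq_outcome (σ : hη.info.SellerStrategy) :
    ∀ᵐ x ∂hη.info.outcome σ, x.1.2.1 = x.1.2.2 :=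
  ae_outcome_of_ae _ σ hη.fullyInformedBuyer_info

/-- Seller's utility is a function of the price and the value. -/
lemma sellerUtility_ae_eq (σ : hη.info.SellerStrategy) :
    sellerUtility (Ts := PricePair R) Γ.thresholdBuyer =ᵐ[hη.info.outcome σ]
      fun x => Γ.gain x.2 x.1.2.2 := by
  filter_upwards [hη.ae_eq_outcome σ] with x hx
  simp [sellerUtility, thresholdBuyer, gain, hx]

lemma buyerUtility_ae_eq (σ : hη.info.SellerStrategy) :
    buyerUtility (Ts := PricePair R) Γ.thresholdBuyer =ᵐ[hη.info.outcome σ]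
      fun x => max 0 ((x.1.2.2 : ℝ) - x.2) := by
  filter_upwards [hη.ae_eq_outcome σ] with x hx
  simp only [buyerUtility, thresholdBuyer, hx]
  split_ifs with h
  · rw [max_eq_right (by linarith), mul_one]
  · rw [max_eq_left (by linarith), mul_zero]

lemma abs_gain_le {M : ℝ} (hM : ∀ v : Γ.V, |Γ.c v| ≤ M) {p : ℝ} (hp : |p| ≤ R) (v : Γ.V) :
    |Γ.gain p v| ≤ R + M := by
  unfold gain
  have h1 := hM v
  have h2 := abs_nonneg p
  have h3 := abs_nonneg (Γ.c v)
  split_ifs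
  · exact (abs_sub _ _).trans (by linarith)
  · rw [abs_zero]
    linarith

/-- The price that Seller posts on path is bounded. -/
lemma ae_abs_price_le (θ : ℝ) (hθ : θ ∈ Set.Icc (0 : ℝ) 1) :
    ∀ᵐ x ∂hη.info.outcome (hη.strategy θ hθ), |x.2| ≤ R := by
  have h : ∀ᵐ y ∂(hη.info.outcome (hη.strategy θ hθ)).map
      (fun x => ((x.1.1, x.2), x.1.2.2)), |y.1.2| ≤ R := by
    have hm : MeasurableSet {y : (PricePair R × ℝ) × Γ.V | |y.1.2| ≤ R} :=
      measurableSet_le (by fun_prop) (by fun_prop)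
    rw [hη.map_outcome_strategy θ hθ]
    refine ae_convexMix ?_ ?_
    · rw [ae_map_iff (by fun_prop) hm]
      exact .of_forall fun x => abs_le.2 x.1.1.2
    · rw [ae_map_iff (by fun_prop) hm]
      exact .of_forall fun x => abs_le.2 x.1.2.2
  exact ae_of_ae_map (by fun_prop) h

lemma integrable_sellerUtility (θ : ℝ) (hθ : θ ∈ Set.Icc (0 : ℝ) 1) :
    Integrable (sellerUtility Γ.thresholdBuyer) (hη.info.outcome (hη.strategy θ hθ)) := by
  obtain ⟨M, hM⟩ := Γ.exists_bound
  rw [integrable_congr (hη.sellerUtility_ae_eq _)]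
  refine .of_bound (measurable_gain.comp (by fun_prop :
    Measurable fun x : (PricePair R × Γ.V × Γ.V) × ℝ => (x.2, x.1.2.2))).aestronglyMeasurable
    (R + M) ?_
  filter_upwards [hη.ae_abs_price_le θ hθ] with x hx
  exact abs_gain_le (fun v => (hM v).2) hx _

lemma integrable_buyerUtility (θ : ℝ) (hθ : θ ∈ Set.Icc (0 : ℝ) 1) :
    Integrable (buyerUtility Γ.thresholdBuyer) (hη.info.outcome (hη.strategy θ hθ)) := by
  obtain ⟨M, hM⟩ := Γ.exists_bound
  rw [integrable_congr (hη.buyerUtility_ae_eq _)]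
  refine .of_bound (Measurable.aestronglyMeasurable (by fun_prop)) (M + R) ?_
  filter_upwards [hη.ae_abs_price_le θ hθ] with x hx
  have h1 := abs_le.1 hx
  have h2 := abs_le.1 (hM x.1.2.2).1
  rw [Real.norm_eq_abs, abs_of_nonneg (le_max_left _ _)]
  exact max_le (by linarith) (by linarith)

/-- The integral of a function of the signal, the price and the value over the outcome. -/
lemma integral_outcome_strategy (θ : ℝ) (hθ : θ ∈ Set.Icc (0 : ℝ) 1)
    {f : ℝ × Γ.V → ℝ} (hf : Measurable f) {B : ℝ} (hB : ∀ p v, |p| ≤ R → |f (p, v)| ≤ B) :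
    ∫ x, f (x.2, x.1.2.2) ∂hη.info.outcome (hη.strategy θ hθ) =
      θ * ∫ x, f (x.1.1, x.2) ∂η + (1 - θ) * ∫ x, f (x.1.2, x.2) ∂η := by
  have := hη.isProbabilityMeasure
  have hf' : Measurable fun y : (PricePair R × ℝ) × Γ.V => f (y.1.2, y.2) := by fun_prop
  have e := integral_map (μ := hη.info.outcome (hη.strategy θ hθ))
    (φ := fun x => ((x.1.1, x.2), x.1.2.2)) (by fun_prop) hf'.aestronglyMeasurable
  simp only at e
  rw [← e, hη.map_outcome_strategy θ hθ, integral_convexMix hθ,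
    integral_map (by fun_prop) hf'.aestronglyMeasurable,
    integral_map (by fun_prop) hf'.aestronglyMeasurable]
  · rw [integrable_map_measure hf'.aestronglyMeasurable (by fun_prop)]
    exact .of_bound (Measurable.aestronglyMeasurable (by fun_prop)) B
      (.of_forall fun x => hB _ _ (abs_le.2 x.1.1.2))
  · rw [integrable_map_measure hf'.aestronglyMeasurable (by fun_prop)]
    exact .of_bound (Measurable.aestronglyMeasurable (by fun_prop)) B
      (.of_forall fun x => hB _ _ (abs_le.2 x.1.2.2))

end IsSegmentation

end Environment

/-! ### Payoffs of equilibria -/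

namespace Environment

open InfoStructure

variable {Γ : Environment}

namespace IsSegmentation

variable {R : ℝ} {η : Measure (PricePair R × Γ.V)} (hη : Γ.IsSegmentation R 0 η)

lemma integral_gain_low (hη : Γ.IsSegmentation R 0 η) :
    ∫ x, Γ.gain x.1.1 x.2 ∂η = ∫ x, ((x.1.1 : ℝ) - Γ.c x.2) ∂η := by
  refine integral_congr_ae ?_
  filter_upwards [hη.between] with x hx
  exact if_pos hx.1

lemma integrable_gain_comp [IsFiniteMeasure η] {g : PricePair R → ℝ} (hg : Measurable g)
    (hgR : ∀ t, |g t| ≤ R) : Integrable (fun x => Γ.gain (g x.1) x.2) η := by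
  obtain ⟨M, hM⟩ := Γ.exists_bound
  exact .of_bound (measurable_gain.comp (by fun_prop :
    Measurable fun x : PricePair R × Γ.V => (g x.1, x.2))).aestronglyMeasurable (R + M)
    (.of_forall fun x => abs_gain_le (fun v => (hM v).2) (hgR _) _)

/-- Seller's two prices earn the same. -/
lemma integral_gain_high (hη : Γ.IsSegmentation R 0 η) :
    ∫ x, Γ.gain x.1.2 x.2 ∂η = ∫ x, ((x.1.1 : ℝ) - Γ.c x.2) ∂η := by
  have := hη.isProbabilityMeasure
  rw [← hη.integral_gain_low,
    ← Measure.integral_condKernel (integrable_gain_comp (g := fun t => (t.1 : ℝ)) (by fun_prop)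
      fun t => abs_le.2 t.1.2),
    ← Measure.integral_condKernel (integrable_gain_comp (g := fun t => (t.2 : ℝ)) (by fun_prop)
      fun t => abs_le.2 t.2.2)]
  refine integral_congr_ae ?_
  filter_upwards [hη.ae_profit_le_low, hη.ae_profit_le_high] with t h₁ h₂
  simp only [← profit_eq_integral_gain]
  exact le_antisymm (h₁ _) (h₂ _)

lemma sellerPayoff_strategy (θ : ℝ) (hθ : θ ∈ Set.Icc (0 : ℝ) 1) :
    hη.info.sellerPayoff (hη.strategy θ hθ) Γ.thresholdBuyer =
      ∫ x, ((x.1.1 : ℝ) - Γ.c x.2) ∂η := by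
  obtain ⟨M, hM⟩ := Γ.exists_bound
  rw [sellerPayoff, integral_congr_ae (hη.sellerUtility_ae_eq _),
    hη.integral_outcome_strategy θ hθ (f := fun y => Γ.gain y.1 y.2) measurable_gain
      (B := R + M) fun p v hp => abs_gain_le (fun v => (hM v).2) hp v]
  simp only
  rw [hη.integral_gain_low, hη.integral_gain_high]
  ring

lemma integral_surplus (hη : Γ.IsSegmentation R 0 η) :
    ∫ x, ((x.2 : ℝ) - Γ.c x.2) ∂η = ∫ v : Γ.V, ((v : ℝ) - Γ.c v) ∂Γ.μ := by
  have := Γ.continuous_c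
  rw [← hη.map_snd, integral_map (by fun_prop)
    (Continuous.aestronglyMeasurable (by fun_prop))]

lemma buyerPayoff_strategy (θ : ℝ) (hθ : θ ∈ Set.Icc (0 : ℝ) 1) :
    hη.info.buyerPayoff (hη.strategy θ hθ) Γ.thresholdBuyer =
      θ * (∫ v : Γ.V, ((v : ℝ) - Γ.c v) ∂Γ.μ - ∫ x, ((x.1.1 : ℝ) - Γ.c x.2) ∂η) := by
  have := hη.isProbabilityMeasure
  have := Γ.continuous_c
  obtain ⟨M, hM⟩ := Γ.exists_bound
  rw [buyerPayoff, integral_congr_ae (hη.buyerUtility_ae_eq _),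
    hη.integral_outcome_strategy θ hθ (f := fun y => max 0 ((y.2 : ℝ) - y.1)) (by fun_prop)
      (B := M + R)]
  · simp only
    have h₂ : ∫ x, max 0 ((x.2 : ℝ) - x.1.2) ∂η = 0 := by
      refine integral_eq_zero_of_ae ?_
      filter_upwards [hη.between] with x hx
      exact max_eq_left (sub_nonpos.2 hx.2)
    have h₁ : ∫ x, max 0 ((x.2 : ℝ) - x.1.1) ∂η =
        ∫ x, (((x.2 : ℝ) - Γ.c x.2) - ((x.1.1 : ℝ) - Γ.c x.2)) ∂η := by
      refine integral_congr_ae ?_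
      filter_upwards [hη.between] with x hx
      rw [max_eq_right (sub_nonneg.2 hx.1)]
      ring
    rw [h₁, h₂, integral_sub (Continuous.integrable_of_compactSpace (by fun_prop))
      (Continuous.integrable_of_compactSpace (by fun_prop)), hη.integral_surplus]
    ring
  · intro p v hp
    have h1 := abs_le.1 hp
    have h2 := abs_le.1 (hM v).1
    rw [abs_of_nonneg (le_max_left _ _)]
    exact max_le (by linarith) (by linarith)

/-- No deviation is profitable for Seller: given her signal, no price beats the lower one. -/
lemma sellerPayoff_le (σ : hη.info.SellerStrategy)
    (hσ : Integrable (sellerUtility Γ.thresholdBuyer) (hη.info.outcome σ)) :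
    hη.info.sellerPayoff σ Γ.thresholdBuyer ≤ ∫ x, ((x.1.1 : ℝ) - Γ.c x.2) ∂η := by
  have := hη.isProbabilityMeasure
  obtain ⟨M, hM⟩ := Γ.exists_bound
  have hfst : σ.law.fst = η.fst := by rw [σ.fst_law, hη.map_fst_info]
  have hmap := map_outcome_eq_compProd _ σ η hη.map_info
  have hgm : Measurable fun y : (PricePair R × ℝ) × Γ.V => Γ.gain y.1.2 y.2 :=
    measurable_gain.comp (by fun_prop : Measurable fun y : (PricePair R × ℝ) × Γ.V =>
      (y.1.2, y.2))
  have hint : Integrable (fun y : (PricePair R × ℝ) × Γ.V => Γ.gain y.1.2 y.2)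
      (σ.law ⊗ₘ η.condKernel.comap Prod.fst measurable_fst) := by
    rw [← hmap, integrable_map_measure hgm.aestronglyMeasurable (by fun_prop)]
    exact (integrable_congr (hη.sellerUtility_ae_eq σ)).1 hσ
  have e := integral_map (μ := hη.info.outcome σ)
    (φ := fun x => ((x.1.1, x.2), x.1.2.2)) (by fun_prop) hgm.aestronglyMeasurable
  simp only at e
  have hm : Measurable fun x : PricePair R × Γ.V => Γ.gain x.1.1 x.2 :=
    measurable_gain.comp (by fun_prop : Measurable fun x : PricePair R × Γ.V =>
      ((x.1.1 : ℝ), x.2))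
  have hm' : Measurable fun t : PricePair R => ∫ v, Γ.gain t.1 v ∂η.condKernel t :=
    (StronglyMeasurable.integral_kernel_prod_right' hm.stronglyMeasurable).measurable
  rw [sellerPayoff, integral_congr_ae (hη.sellerUtility_ae_eq σ), ← e, hmap,
    Measure.integral_compProd hint]
  calc ∫ y, ∫ v, Γ.gain y.2 v ∂η.condKernel y.1 ∂σ.law
      ≤ ∫ y, ∫ v, Γ.gain y.1.1 v ∂η.condKernel y.1 ∂σ.law := by
        have hint' : Integrable (fun y : PricePair R × ℝ => ∫ v, Γ.gain y.2 v ∂η.condKernel y.1)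
            σ.law := by
          rw [Measure.compProd] at hint
          simpa using hint.integral_compProd
        refine integral_mono_ae hint' ?_ ?_
        · refine .of_bound (hm'.comp measurable_fst).aestronglyMeasurable (R + M)
            (.of_forall fun y => ?_)
          refine (norm_integral_le_of_norm_le_const (C := R + M) (.of_forall fun v =>
            abs_gain_le (fun v => (hM v).2) (abs_le.2 y.1.1.2) v)).trans ?_
          simp
        · have h := hη.ae_profit_le_low
          rw [← hfst] at h
          filter_upwards [ae_of_ae_map measurable_fst.aemeasurable h] with y hy
          simp only [← profit_eq_integral_gain]
          exact hy y.2
    _ = ∫ t, ∫ v, Γ.gain t.1 v ∂η.condKernel t ∂η.fst := by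
        rw [← hfst, Measure.fst, integral_map (by fun_prop) hm'.aestronglyMeasurable]
    _ = ∫ x, ((x.1.1 : ℝ) - Γ.c x.2) ∂η := by
        rw [← hη.integral_gain_low, Measure.integral_condKernel (integrable_gain_comp
          (g := fun t => (t.1 : ℝ)) (by fun_prop) fun t => abs_le.2 t.1.2)]

lemma isWPBE (θ : ℝ) (hθ : θ ∈ Set.Icc (0 : ℝ) 1) :
    hη.info.IsWPBE (hη.strategy θ hθ) Γ.thresholdBuyer Γ.truthfulBelief where
  isMarkovKernel := by
    unfold truthfulBelief
    infer_instance
  accept p t h := by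
    rw [truthfulBelief, Kernel.deterministic_apply, integral_dirac] at h
    exact if_pos h.le
  reject p t h := by
    rw [truthfulBelief, Kernel.deterministic_apply, integral_dirac] at h
    exact if_neg (not_le.2 h)
  integrable_seller := hη.integrable_sellerUtility θ hθ
  integrable_buyer := hη.integrable_buyerUtility θ hθ
  seller_optimal σ hσ := by
    rw [hη.sellerPayoff_strategy]
    exact hη.sellerPayoff_le σ hσ
  bayes := by
    have : IsProbabilityMeasure ((hη.info.outcome (hη.strategy θ hθ)).map
        (fun x => (x.2, x.1.2.1))) := Measure.isProbabilityMeasure_map (by fun_prop)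
    rw [truthfulBelief, Measure.compProd_deterministic, Measure.map_map (by fun_prop)
      (by fun_prop)]
    refine Measure.map_congr ?_
    filter_upwards [hη.ae_eq_outcome (hη.strategy θ hθ)] with x hx
    simp [hx]

lemma priceIndependent : hη.info.PriceIndependent Γ.truthfulBelief := by
  intro p
  have : IsProbabilityMeasure (hη.info.P.map (fun x => x.2.1)) :=
    Measure.isProbabilityMeasure_map (by fun_prop)
  have h : Γ.truthfulBelief.comap (fun t => (p, t)) measurable_prodMk_left =
      Kernel.deterministic (fun t : Γ.V => t) measurable_id := by
    ext t : 1
    rw [Kernel.comap_apply, truthfulBelief, Kernel.deterministic_apply, Kernel.deterministic_apply]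
  rw [h, Measure.compProd_deterministic, Measure.map_map (by fun_prop) (by fun_prop)]
  refine Measure.map_congr ?_
  filter_upwards [hη.fullyInformedBuyer_info] with x hx
  simp [hx]

end IsSegmentation

/-- Every payoff pair in the triangle is implementable: mix the segmentation that is worst for
Seller with full revelation to obtain Seller's payoff, and let Seller mix between the lower and the
higher price of her signal to divide the remaining surplus. -/
lemma mem_implementableFB {b s : ℝ} (hb : 0 ≤ b) (hs : Γ.sellerGuaranteeFB ≤ s)
    (hbs : b + s ≤ ∫ v : Γ.V, ((v : ℝ) - Γ.c v) ∂Γ.μ) : (b, s) ∈ Γ.implementableFB := by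
  obtain ⟨M, hM⟩ := Γ.exists_bound
  have := Γ.continuous_c
  obtain ⟨η₀, hη₀, hle⟩ := exists_isSegmentation fun v => (hM v).1
  have hR (v : Γ.V) : (v : ℝ) ∈ Set.Icc (-(M + 1)) (M + 1) := by
    have := abs_le.1 (hM v).1
    constructor <;> linarith
  have hfull := isSegmentation_fullRevelation hR
  have := hη₀.isProbabilityMeasure
  have := hfull.isProbabilityMeasure
  set W := ∫ v : Γ.V, ((v : ℝ) - Γ.c v) ∂Γ.μ
  set s₀ := ∫ x, ((x.1.1 : ℝ) - Γ.c x.2) ∂η₀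
  have hθ : (W - s) / (W - s₀) ∈ Set.Icc (0 : ℝ) 1 :=
    ⟨div_nonneg (by linarith) (by linarith), div_le_one_of_le₀ (by linarith) (by linarith)⟩
  have hlam : b / (W - s) ∈ Set.Icc (0 : ℝ) 1 :=
    ⟨div_nonneg hb (by linarith), div_le_one_of_le₀ (by linarith) (by linarith)⟩
  have hη := hη₀.mix hfull hθ
  have hs' : ∫ x, ((x.1.1 : ℝ) - Γ.c x.2)
      ∂convexMix ((W - s) / (W - s₀)) η₀ (Γ.fullRevelation hR) = s := by
    rw [integral_convexMix hθ (Continuous.integrable_of_compactSpace (by fun_prop))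
      (Continuous.integrable_of_compactSpace (by fun_prop)),
      integral_fullRevelation hR (by fun_prop)]
    change (W - s) / (W - s₀) * s₀ + (1 - (W - s) / (W - s₀)) * W = s
    -- if `W = s₀`, the division is by zero, but then `s = W` as well
    rcases eq_or_ne (W - s₀) 0 with h0 | h0
    · rw [h0, div_zero]
      linarith
    · field_simp
      ring
  refine ⟨PricePair (M + 1), inferInstance, inferInstance, inferInstance, inferInstance, hη.info,
    hη.fullyInformedBuyer_info, hη.strategy _ hlam, Γ.thresholdBuyer, Γ.truthfulBelief,
    hη.isWPBE _ hlam, hη.priceIndependent, ?_⟩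
  rw [hη.sellerPayoff_strategy, hη.buyerPayoff_strategy, hs']
  refine Prod.ext ?_ rfl
  change b = b / (W - s) * (W - s)
  rcases eq_or_ne (W - s) 0 with h0 | h0
  · rw [h0, mul_zero]
    linarith
  · rw [div_mul_cancel₀ _ h0]

end Environment

namespace InfoStructure

variable {Γ : Environment} {Ts Tb : Type} [MeasurableSpace Ts] [MeasurableSpace Tb]
  {τ : InfoStructure Γ Ts Tb} {σ : τ.SellerStrategy} {α : BuyerStrategy Tb}
  {ν : Kernel (ℝ × Tb) Γ.V}

lemma IsWPBE.buyerPayoff_nonneg (h : τ.IsWPBE σ α ν) : 0 ≤ τ.buyerPayoff σ α := by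
  have := h.isMarkovKernel
  have hα := α.measurable_prob
  have : IsProbabilityMeasure ((τ.outcome σ).map (fun x => (x.2, x.1.2.1))) :=
    Measure.isProbabilityMeasure_map (by fun_prop)
  have hm : Measurable fun y : (ℝ × Tb) × Γ.V => ((y.2 : ℝ) - y.1.1) * α.prob y.1 := by fun_prop
  have e := integral_map (μ := τ.outcome σ) (φ := fun x => ((x.2, x.1.2.1), x.1.2.2))
    (by fun_prop) hm.aestronglyMeasurable
  have hint : Integrable (fun y : (ℝ × Tb) × Γ.V => ((y.2 : ℝ) - y.1.1) * α.prob y.1)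
      ((τ.outcome σ).map (fun x => (x.2, x.1.2.1)) ⊗ₘ ν) := by
    rw [h.bayes, integrable_map_measure hm.aestronglyMeasurable (by fun_prop)]
    exact h.integrable_buyer
  change 0 ≤ ∫ x, buyerUtility α x ∂τ.outcome σ
  simp only [buyerUtility]
  simp only at e
  rw [← e, ← h.bayes, Measure.integral_compProd hint]
  refine integral_nonneg fun y => ?_
  simp only [Pi.zero_apply]
  rw [integral_mul_const, integral_sub (continuous_subtype_val.integrable_of_compactSpace)
    (integrable_const _), integral_const, probReal_univ, one_smul]
  rcases lt_or_ge (∫ v : Γ.V, (v : ℝ) ∂ν y) y.1 with hlt | hge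
  · rw [h.reject y.1 y.2 hlt, mul_zero]
  · exact mul_nonneg (sub_nonneg.2 hge) (α.prob_mem y).1

lemma IsWPBE.payoff_sum_le (h : τ.IsWPBE σ α ν) :
    τ.buyerPayoff σ α + τ.sellerPayoff σ α ≤ ∫ v : Γ.V, ((v : ℝ) - Γ.c v) ∂Γ.μ := by
  have hc := Γ.continuous_c
  have hmap : (τ.outcome σ).map (fun x => x.1.2.2) = Γ.μ := by
    rw [← τ.map_value, ← τ.fst_outcome σ, Measure.fst, Measure.map_map (by fun_prop)
      (by fun_prop)]
    rfl
  have hcont : Continuous fun v : Γ.V => (v : ℝ) - Γ.c v := by fun_prop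
  have hint : Integrable (fun x : (Ts × Tb × Γ.V) × ℝ => (x.1.2.2 : ℝ) - Γ.c x.1.2.2)
      (τ.outcome σ) := by
    have : Integrable (fun v : Γ.V => (v : ℝ) - Γ.c v)
        ((τ.outcome σ).map (fun x => x.1.2.2)) := by
      rw [hmap]
      exact hcont.integrable_of_compactSpace
    exact this.comp_measurable (by fun_prop)
  rw [buyerPayoff, sellerPayoff, ← integral_add h.integrable_buyer h.integrable_seller, ← hmap,
    integral_map (by fun_prop) hcont.aestronglyMeasurable]
  refine integral_mono (h.integrable_buyer.add h.integrable_seller) hint fun x => ?_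
  have h1 := α.prob_mem (x.2, x.1.2.1)
  have h2 := Γ.c_le x.1.2.2
  simp only [buyerUtility, sellerUtility]
  nlinarith [h1.1, h1.2]

/-- The strategy of posting the price `p` regardless of the signal. -/
def constStrategy (τ : InfoStructure Γ Ts Tb) (p : ℝ) : τ.SellerStrategy where
  law := (τ.P.map (fun x => x.1)).map fun t => (t, p)
  isProbabilityMeasure_law := by
    have : IsProbabilityMeasure (τ.P.map (fun x => x.1)) :=
      Measure.isProbabilityMeasure_map (by fun_prop)
    exact Measure.isProbabilityMeasure_map (by fun_prop)
  fst_law := by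
    rw [Measure.fst, Measure.map_map (by fun_prop) (by fun_prop)]
    exact Measure.map_id

lemma ae_constStrategy (p : ℝ) : ∀ᵐ x ∂τ.outcome (τ.constStrategy p), x.2 = p := by
  have : IsProbabilityMeasure (τ.P.map (fun x => (x.1, x.2.2))) :=
    Measure.isProbabilityMeasure_map (by fun_prop)
  have hlaw : (τ.outcome (τ.constStrategy p)).map (fun x => (x.1.1, x.2)) =
      (τ.constStrategy p).law := by
    have h := congrArg Measure.fst (map_outcome_eq_compProd τ (τ.constStrategy p) _ rfl)
    rw [Measure.fst_compProd, Measure.fst, Measure.map_map (by fun_prop) (by fun_prop)] at h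
    exact h
  have h : ∀ᵐ y ∂(τ.constStrategy p).law, y.2 = p := by
    rw [constStrategy, ae_map_iff (by fun_prop) (measurableSet_eq_fun (by fun_prop) (by fun_prop))]
    exact .of_forall fun t => rfl
  rw [← hlaw] at h
  exact ae_of_ae_map (by fun_prop) h

/-- Against a fully informed Buyer with price-independent beliefs, Seller earns at least the profit
from any fixed price when the values above the price buy. -/
lemma IsWPBE.integral_le_sellerPayoff {τ : InfoStructure Γ Ts Γ.V} {σ : τ.SellerStrategy}
    {α : BuyerStrategy Γ.V} {ν : Kernel (ℝ × Γ.V) Γ.V} (h : τ.IsWPBE σ α ν)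
    (hτ : τ.FullyInformedBuyer) (hν : τ.PriceIndependent ν) (p : ℝ) :
    ∫ v : Γ.V, (if p < (v : ℝ) then p - Γ.c v else 0) ∂Γ.μ ≤ τ.sellerPayoff σ α := by
  have := h.isMarkovKernel
  have hc := Γ.continuous_c.measurable
  have hα := α.measurable_prob
  obtain ⟨M, hM⟩ := Γ.exists_bound
  have hbelief : ∀ᵐ x ∂τ.P, ∫ v : Γ.V, (v : ℝ) ∂ν (p, x.2.1) = x.2.1 := by
    have : IsProbabilityMeasure (τ.P.map (fun x => x.2.1)) :=
      Measure.isProbabilityMeasure_map (by fun_prop)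
    have e : τ.P.map (fun x => x.2.1) ⊗ₘ ν.comap (fun t => (p, t)) measurable_prodMk_left =
        τ.P.map (fun x => x.2.1) ⊗ₘ Kernel.deterministic (fun t : Γ.V => t) measurable_id := by
      rw [hν p, Measure.compProd_deterministic, Measure.map_map (by fun_prop) (by fun_prop)]
      refine Measure.map_congr ?_
      filter_upwards [hτ] with x hx
      simp [hx]
    filter_upwards [ae_of_ae_map (by fun_prop) (Kernel.ae_eq_of_compProd_eq e)] with x hx
    rw [Kernel.comap_apply] at hx
    rw [hx, Kernel.deterministic_apply, integral_dirac]
  have hconst : ∀ᵐ x ∂τ.outcome (τ.constStrategy p),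
      sellerUtility α x = (p - Γ.c x.1.2.2) * α.prob (p, x.1.2.1) := by
    filter_upwards [ae_constStrategy p] with x hx
    rw [sellerUtility, hx]
  have hbound (x : Ts × Γ.V × Γ.V) : ‖(p - Γ.c x.2.2) * α.prob (p, x.2.1)‖ ≤ |p| + M := by
    have h1 := α.prob_mem (p, x.2.1)
    have h2 : |p - Γ.c x.2.2| ≤ |p| + M := (abs_sub _ _).trans (by linarith [(hM x.2.2).2])
    rw [norm_mul, Real.norm_eq_abs, Real.norm_eq_abs, abs_of_nonneg h1.1]
    calc _ ≤ |p - Γ.c x.2.2| * 1 := by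
          gcongr
          exact h1.2
      _ ≤ |p| + M := by rwa [mul_one]
  have hint : Integrable (sellerUtility α) (τ.outcome (τ.constStrategy p)) := by
    rw [integrable_congr hconst]
    exact .of_bound (Measurable.aestronglyMeasurable (by fun_prop)) (|p| + M)
      (.of_forall fun x => hbound x.1)
  have hm : Measurable fun x : Ts × Γ.V × Γ.V => (p - Γ.c x.2.2) * α.prob (p, x.2.1) := by
    fun_prop
  have hval : τ.sellerPayoff (τ.constStrategy p) α =
      ∫ x, (p - Γ.c x.2.2) * α.prob (p, x.2.1) ∂τ.P := by
    rw [sellerPayoff, integral_congr_ae hconst]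
    conv_rhs => rw [← τ.fst_outcome (τ.constStrategy p), Measure.fst]
    rw [integral_map (by fun_prop) hm.aestronglyMeasurable]
  refine le_trans ?_ (h.seller_optimal _ hint)
  have hgm : Measurable fun v : Γ.V => if p < (v : ℝ) then p - Γ.c v else 0 :=
    Measurable.ite (measurableSet_lt (by fun_prop) (by fun_prop)) (by fun_prop) (by fun_prop)
  rw [hval, ← τ.map_value, integral_map (by fun_prop) hgm.aestronglyMeasurable]
  refine integral_mono_ae ?_ (.of_bound hm.aestronglyMeasurable (|p| + M) (.of_forall hbound)) ?_
  · refine .of_bound (hgm.comp (by fun_prop)).aestronglyMeasurable (|p| + M)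
      (.of_forall fun x => ?_)
    rw [Real.norm_eq_abs]
    have h0 := abs_nonneg (Γ.c x.2.2)
    have h1 := (hM x.2.2).2
    split_ifs
    · exact (abs_sub _ _).trans (by linarith)
    · rw [abs_zero]
      have := abs_nonneg p
      linarith
  · filter_upwards [hbelief, hτ] with x hx hxv
    rw [hxv] at hx ⊢
    rcases lt_trichotomy p (x.2.2 : ℝ) with hlt | heq | hgt
    · rw [if_pos hlt, h.accept p x.2.2 (by rwa [hx]), mul_one]
    · rw [if_neg heq.not_lt]
      have := Γ.c_le x.2.2
      exact mul_nonneg (by linarith) (α.prob_mem _).1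
    · rw [if_neg hgt.not_gt, h.reject p x.2.2 (by rwa [hx]), mul_zero]

lemma IsWPBE.sellerGuaranteeFB_le {τ : InfoStructure Γ Ts Γ.V} {σ : τ.SellerStrategy}
    {α : BuyerStrategy Γ.V} {ν : Kernel (ℝ × Γ.V) Γ.V} (h : τ.IsWPBE σ α ν)
    (hτ : τ.FullyInformedBuyer) (hν : τ.PriceIndependent ν) :
    Γ.sellerGuaranteeFB ≤ τ.sellerPayoff σ α := by
  refine ciSup_le fun p => le_of_forall_pos_le_add fun ε hε => ?_
  change Γ.profit Γ.μ p ≤ _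
  -- Buyers with value `p` may reject the price `p`, but they accept a slightly lower price
  have h1 := h.integral_le_sellerPayoff hτ hν (p - ε)
  have hc := Γ.continuous_c.measurable
  have hi : Integrable (fun v : Γ.V => if p - ε < (v : ℝ) then p - ε - Γ.c v else 0) Γ.μ :=
    ((integrable_const (p - ε)).sub Environment.integrable_c).indicator
      (measurableSet_lt measurable_const measurable_subtype_coe)
  have h2 : Γ.profit Γ.μ p ≤
      ∫ v : Γ.V, ((if p - ε < (v : ℝ) then p - ε - Γ.c v else 0) + ε) ∂Γ.μ := by
    rw [Environment.profit_eq_integral_gain]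
    refine integral_mono (Environment.integrable_gain p) (hi.add (integrable_const _)) fun v => ?_
    have := Γ.c_le v
    simp only [Environment.gain]
    split_ifs <;> linarith
  rw [integral_add hi (integrable_const _)] at h2
  simp only [integral_const, probReal_univ, smul_eq_mul, one_mul] at h2
  linarith

end InfoStructure

end

theorem theorem3 (Γ : Environment) :
    Γ.implementableFB =
      {π : ℝ × ℝ | π ∈ Γ.implementable ∧ Γ.sellerGuaranteeFB ≤ π.2} := by
  ext ⟨b, s⟩
  constructor
  · rintro ⟨Ts, i₁, i₂, i₃, i₄, τ, hτ, σ, α, ν, h, hν, e⟩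
    refine ⟨⟨Ts, i₁, i₂, i₃, i₄, Γ.V, inferInstance, inferInstance, inferInstance, inferInstance,
      τ, σ, α, ν, h, e⟩, ?_⟩
    rw [e]
    exact h.sellerGuaranteeFB_le hτ hν
  · rintro ⟨⟨Ts, _, _, _, _, Tb, _, _, _, _, τ, σ, α, ν, h, e⟩, hs⟩
    obtain ⟨rfl, rfl⟩ := Prod.mk.inj e
    exact Environment.mem_implementableFB h.buyerPayoff_nonneg hs h.payoff_sum_le
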